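/- Conventions. Manifolds are Hausdorff, second countable and without boundary. A Jacobi manifold $(M,\pi,E)$ of class $C^r$ ($r=\infty$: smooth, $r=\omega$: real analytic) is a manifold with a bivector field $\pi$ and a vector field $E$ of class $C^r$ such that $[E,\pi]=0$ and $[\pi,\pi]=2\,E\wedge\pi$ (Schouten bracket, with $[\pi,\pi](df,dg,dh)=2(\{f,\{g,h\}\}+\{g,\{h,f\}\}+\{h,\{f,g\}\})$ for $\{f,g\}=\pi(df,dg)$). If $\dim M=2n+1$, $n\ge 0$, a point is regular if $\pi^n\wedge E$ does not vanish there, and singular otherwise; $M$ is contact on a dense open set if all points of some dense open set are regular, and it is a contact manifold if every point is regular. The field $E$ is of Euler type near $p\in M$ if there are $C^r$ local coordinates $(x_1,\dots,x_{2n+1})$ defined near $p$ and centred at $p$ (all $x_i(p)=0$) in which $E=\sum_i x_i\,\partial_{x_i}$. A contact resolution of class $C^r$ of $(M,\pi,E)$ is a contact manifold $(\Sigma,\pi_\Sigma,E_\Sigma)$ of class $C^r$ with $\dim\Sigma=\dim M$, together with a surjective $C^r$ map $\varphi:\Sigma\to M$ that is a Jacobi morphism: $\wedge^2T_\sigma\varphi(\pi_\Sigma(\sigma))=\pi(\varphi(\sigma))$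 and $T_\sigma\varphi(E_\Sigma(\sigma))=E(\varphi(\sigma))$ for all $\sigma\in\Sigma$. It is proper if $\varphi$ is a proper map, and semi-connected if $\varphi$ maps no connected component of $\Sigma$ into the set of singular points of $M$. Proposition. Let $(M,\pi,E)$ be a Jacobi manifold of dimension $2n+1$ that is contact on a dense open set and such that $E$ is of Euler type near some point $p\in M$. (1) If $(M,\pi,E)$ is smooth, then it admits no proper smooth contact resolution. (2) If $(M,\pi,E)$ is real analytic (with real analytic Euler coordinates), then it admits no semi-connected real analytic contact resolution. -/

import Mathlib

open scoped Manifold ContDiff Topology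

universe u v

namespace JacobiGeom

noncomputable section

/-- The model vector space of a `d`-dimensional manifold. -/
abbrev Model (d : ℕ) : Type := EuclideanSpace ℝ (Fin d)

/-- The value `w(α, β)` of a bivector `w ∈ ⋀² V` on two covectors, normalised by
`(u ∧ v)(α, β) = α u * β v - α v * β u`. -/
def bivectorEval {V : Type*} [AddCommGroup V] [Module ℝ V] (w : ⋀[ℝ]^2 V)
    (α β : Module.Dual ℝ V) : ℝ :=
  exteriorPower.alternatingMapToDual ℝ V 2 ![α, β] w

/-- The normalisation announced in the definition of `bivectorEval`. -/
theorem bivectorEval_wedge {V : Type*} [AddCommGroup V] [Module ℝ V] (u v : V)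
    (α β : Module.Dual ℝ V) :
    bivectorEval (exteriorPower.ιMulti ℝ 2 ![u, v]) α β = α u * β v - α v * β u := by
  simp [bivectorEval, Matrix.det_fin_two]
  ring

section Manifold

variable {d : ℕ} {M : Type*} [TopologicalSpace M] [ChartedSpace (Model d) M]

/-- A (not necessarily smooth) vector field on `M`. -/
abbrev VField (d : ℕ) (M : Type*) [TopologicalSpace M] [ChartedSpace (Model d) M] : Type _ :=
  ∀ x : M, TangentSpace (𝓡 d) x

/-- A (not necessarily smooth) bivector field on `M`. -/
abbrev BivField (d : ℕ) (M : Type*) [TopologicalSpace M] [ChartedSpace (Model d) M] : Type _ :=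
  ∀ x : M, ⋀[ℝ]^2 (TangentSpace (𝓡 d) x)

/-- The differential at `x` of a real function, as a covector. -/
def dfAt (f : M → ℝ) (x : M) : Module.Dual ℝ (TangentSpace (𝓡 d) x) :=
  (mfderiv (𝓡 d) 𝓘(ℝ, ℝ) f x : TangentSpace (𝓡 d) x →L[ℝ] ℝ).toLinearMap

/-- The function `E[f] = df(E)`. -/
def VField.app (E : VField d M) (f : M → ℝ) : M → ℝ :=
  fun x => dfAt (d := d) f x (E x)

/-- The function `π(df, dg)`. -/
def BivField.bracket (π : BivField d M) (f g : M → ℝ) : M → ℝ :=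
  fun x => bivectorEval (π x) (dfAt f x) (dfAt g x)

/-- A bivector field is of class `C^r` if `π(df, dg)` is of class `C^r` on `U` for all functions
`f`, `g` of class `C^r` on an open set `U`. Used for `r = ∞` and `r = ω` only. -/
def BivField.IsSmooth (r : WithTop ℕ∞) (π : BivField d M) : Prop :=
  ∀ U : Set M, IsOpen U → ∀ f g : M → ℝ,
    ContMDiffOn (𝓡 d) 𝓘(ℝ, ℝ) r f U → ContMDiffOn (𝓡 d) 𝓘(ℝ, ℝ) r g U →
      ContMDiffOn (𝓡 d) 𝓘(ℝ, ℝ) r (π.bracket f g) U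

/-- `(M, π, E)` is a Jacobi manifold of class `C^r` (`r = ∞`: smooth, `r = ω`: real analytic):
`π` and `E` are of class `C^r`, `[E, π] = 0` and `[π, π] = 2 E ∧ π`. Both identities of
multivector fields are written out on the differentials of local functions, with
`[E, π](df, dg) = E[π(df, dg)] - π(dE[f], dg) - π(df, dE[g])` and
`[π, π](df, dg, dh) = 2 ({f, {g, h}} + {g, {h, f}} + {h, {f, g}})`, where `{f, g} = π(df, dg)`. -/
structure IsJacobi [IsManifold (𝓡 d) 1 M] (r : WithTop ℕ∞)
    (π : BivField d M) (E : VField d M) : Prop where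
  smooth_biv : π.IsSmooth r
  smooth_vec : ContMDiff (𝓡 d) (𝓡 d).tangent r (fun x => (⟨x, E x⟩ : TangentBundle (𝓡 d) M))
  lie_biv : ∀ U : Set M, IsOpen U → ∀ f g : M → ℝ,
    ContMDiffOn (𝓡 d) 𝓘(ℝ, ℝ) ∞ f U → ContMDiffOn (𝓡 d) 𝓘(ℝ, ℝ) ∞ g U → ∀ x ∈ U,
      E.app (π.bracket f g) x - π.bracket (E.app f) g x - π.bracket f (E.app g) x = 0
  schouten : ∀ U : Set M, IsOpen U → ∀ f g h : M → ℝ,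
    ContMDiffOn (𝓡 d) 𝓘(ℝ, ℝ) ∞ f U → ContMDiffOn (𝓡 d) 𝓘(ℝ, ℝ) ∞ g U →
    ContMDiffOn (𝓡 d) 𝓘(ℝ, ℝ) ∞ h U → ∀ x ∈ U,
      2 * (π.bracket f (π.bracket g h) x + π.bracket g (π.bracket h f) x
          + π.bracket h (π.bracket f g) x)
        = 2 * (E.app f x * π.bracket g h x + E.app g x * π.bracket h f x
          + E.app h x * π.bracket f g x)

/-- In dimension `2n + 1`: the point `x` is regular if `π^n ∧ E` does not vanish at `x`
(the product is taken in the exterior algebra of the tangent space). -/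
def IsRegularPt {n : ℕ} {M : Type*} [TopologicalSpace M] [ChartedSpace (Model (2 * n + 1)) M]
    (π : BivField (2 * n + 1) M) (E : VField (2 * n + 1) M) (x : M) : Prop :=
  (π x : ExteriorAlgebra ℝ (TangentSpace (𝓡 (2 * n + 1)) x)) ^ n
    * ExteriorAlgebra.ι ℝ (E x) ≠ 0

/-- The singular locus: the set of points where `π^n ∧ E` vanishes. -/
def singularLocus {n : ℕ} {M : Type*} [TopologicalSpace M] [ChartedSpace (Model (2 * n + 1)) M]
    (π : BivField (2 * n + 1) M) (E : VField (2 * n + 1) M) : Set M :=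
  {x | ¬ IsRegularPt π E x}

/-- `(π, E)` is contact on a dense open set. -/
def IsContactOnDenseOpen {n : ℕ} {M : Type*} [TopologicalSpace M]
    [ChartedSpace (Model (2 * n + 1)) M]
    (π : BivField (2 * n + 1) M) (E : VField (2 * n + 1) M) : Prop :=
  ∃ U : Set M, IsOpen U ∧ Dense U ∧ ∀ x ∈ U, IsRegularPt π E x

/-- A contact structure of class `C^r`, viewed as a Jacobi structure `(π, E)` such that `π^n ∧ E`
vanishes at no point. -/
structure IsContact {n : ℕ} {M : Type*} [TopologicalSpace M] [ChartedSpace (Model (2 * n + 1)) M]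
    [IsManifold (𝓡 (2 * n + 1)) 1 M] (r : WithTop ℕ∞)
    (π : BivField (2 * n + 1) M) (E : VField (2 * n + 1) M) : Prop where
  jacobi : IsJacobi r π E
  regular : ∀ x, IsRegularPt π E x

/-- `φ` is a Jacobi morphism of class `C^r`: a `C^r` map under which `πS` and `ES` project onto
`π` and `E`. -/
structure IsJacobiMorphism {S : Type*} [TopologicalSpace S] [ChartedSpace (Model d) S]
    (r : WithTop ℕ∞) (πS : BivField d S) (ES : VField d S)
    (π : BivField d M) (E : VField d M) (φ : S → M) : Prop where
  smooth : ContMDiff (𝓡 d) (𝓡 d) r φ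
  map_biv : ∀ s, exteriorPower.map 2 (mfderiv (𝓡 d) (𝓡 d) φ s).toLinearMap (πS s) = π (φ s)
  map_vec : ∀ s, mfderiv (𝓡 d) (𝓡 d) φ s (ES s) = E (φ s)

/-- `((S, πS, ES), φ)` is a contact resolution of class `C^r` of `(M, π, E)`: the manifold `S` is a
contact manifold of the same dimension and `φ` is a surjective Jacobi morphism. -/
structure IsContactResolution {n : ℕ}
    {M : Type*} [TopologicalSpace M] [ChartedSpace (Model (2 * n + 1)) M]
    {S : Type*} [TopologicalSpace S] [ChartedSpace (Model (2 * n + 1)) S]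
    [IsManifold (𝓡 (2 * n + 1)) 1 S] (r : WithTop ℕ∞)
    (πS : BivField (2 * n + 1) S) (ES : VField (2 * n + 1) S)
    (π : BivField (2 * n + 1) M) (E : VField (2 * n + 1) M) (φ : S → M) : Prop where
  contact : IsContact r πS ES
  morphism : IsJacobiMorphism r πS ES π E φ
  surjective : Function.Surjective φ

/-- No connected component of `S` is mapped into the singular locus. -/
def IsSemiConnected {n : ℕ}
    {M : Type*} [TopologicalSpace M] [ChartedSpace (Model (2 * n + 1)) M]
    {S : Type*} [TopologicalSpace S]
    (π : BivField (2 * n + 1) M) (E : VField (2 * n + 1) M) (φ : S → M) : Prop :=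
  ∀ s : S, ¬ (φ '' connectedComponent s ⊆ singularLocus π E)

/-- `E` is of Euler type near `p`: there are `C^r` coordinates `x = (x_1, …, x_d)` centred at `p`
in which `E = ∑ x_i ∂/∂x_i`, that is, `E[x_i] = x_i` for all `i`. -/
def IsEulerTypeAt (r : WithTop ℕ∞) (E : VField d M) (p : M) : Prop :=
  ∃ e ∈ IsManifold.maximalAtlas (𝓡 d) r M, p ∈ e.source ∧ e p = 0 ∧
    ∀ x ∈ e.source, ∀ i : Fin d, E.app (fun y => e y i) x = e x i

end Manifold

end

end JacobiGeom

/-! Let `d = 2n + 1`. In Euler coordinates, `[E, π] = 0` tested on coordinate functions says that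
the coefficients of `π` satisfy Euler's equation of degree 2 (`fderiv_locBiv_euler`), so the
coefficient `f` of `π^n ∧ E` is homogeneous of degree `2n + 1 = d` under positive scalings. If `F`
is a resolution read in charts and `q` the nowhere vanishing coefficient of the top multivector
upstairs, then `f ∘ F = det DF · q` (`topCoord_locMap`). Hence the points over the singular locus
are exactly the critical points of `F`.

Smooth case: homogeneity gives `|f(x)| ≤ C ‖x‖^d`, so `|det DF| ≤ C' ‖F‖^d` near each point over `p`
(`exists_jacobian_bound`). The image of `{0 < ‖F‖ < ρ}` then has volume at most `C' ρ^d` times the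
volume of that set, which tends to 0; the image has volume `o(ρ^d)`. Properness lets finitely many
such pieces cover a punctured ball around `p`, of volume comparable to `ρ^d`, which is impossible
(`not_punctured_ball_subset_iUnion_image`).

Analytic case: analyticity extends the homogeneity of `π` to negative scalings, so `π` is even and
`f` is odd. Since `f` is not identically zero it changes sign, and its zeros project onto an open
set of `ℝ^{2n}` (`exists_projection_zeros`). These zeros are images of critical points of `F`, and
that projected image is null (`measure_image_critical_eq_zero`). Indeed, `J = det DF` vanishes
identically near no point, by semi-connectedness. A vector field `X` related by `F` to `Y` satisfies
`X(J) = (div Y ∘ F - div X) J`, so it preserves the ideals generated by the derivatives of `J` up to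
a given order. At a zero of `J`, choose a derivative `g` of `J` with `dg ≠ 0` there while all
derivatives up to its order vanish. Then `dg` annihilates `E` and all `π(F^*α, ·)` upstairs.
Nondegeneracy upstairs forbids `DF` from being injective on `ker dg`; so the projection of `F` is
critical along the hypersurface `g = 0`, of dimension `2n`, and Sard's lemma in equal dimensions
applies, once for each of countably many `g`. -/

namespace JacobiGeom

noncomputable section

/-! ### Multilinear algebra of the top multivector `w^n ∧ e`. -/

/-- The standard basis of the model space. -/
abbrev stdBasis (d : ℕ) : Module.Basis (Fin d) ℝ (Model d) := (EuclideanSpace.basisFun (Fin d) ℝ).toBasis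

/-- The linear functional on the exterior algebra of `ℝ^d` which is the determinant in degree `d`
and vanishes in all other degrees. -/
def topCoeff (d : ℕ) : ExteriorAlgebra ℝ (Model d) →ₗ[ℝ] ℝ :=
  ExteriorAlgebra.liftAlternating (Pi.single d (stdBasis d).det)

theorem topCoeff_ιMulti {d : ℕ} (v : Fin d → Model d) :
    topCoeff d (ExteriorAlgebra.ιMulti ℝ d v) = (stdBasis d).det v := by
  simp [topCoeff, ExteriorAlgebra.liftAlternating_apply_ιMulti]

theorem topCoeff_map {d : ℕ} (T : Model d →ₗ[ℝ] Model d) {a : ExteriorAlgebra ℝ (Model d)}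
    (ha : a ∈ ⋀[ℝ]^d (Model d)) :
    topCoeff d (ExteriorAlgebra.map T a) = LinearMap.det T * topCoeff d a := by
  rw [← ExteriorAlgebra.ιMulti_span_fixedDegree] at ha
  induction ha using Submodule.span_induction with
  | mem x hx =>
    obtain ⟨v, rfl⟩ := hx
    rw [ExteriorAlgebra.map_apply_ιMulti, topCoeff_ιMulti, topCoeff_ιMulti, Module.Basis.det_comp]
  | zero => simp
  | add x y _ _ hx hy => simp [hx, hy, mul_add]
  | smul c x _ hx => simp [hx]; ring

/-- The top exterior power is a line, spanned by the wedge of the standard basis, on which the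
functional takes the value 1. -/
theorem topCoeff_eq_zero_iff {d : ℕ} {a : ExteriorAlgebra ℝ (Model d)}
    (ha : a ∈ ⋀[ℝ]^d (Model d)) : topCoeff d a = 0 ↔ a = 0 := by
  refine ⟨fun h => ?_, fun h => by simp [h]⟩
  have h1 : Module.finrank ℝ (⋀[ℝ]^d (Model d)) = 1 := by simp [exteriorPower.finrank_eq]
  have hb : topCoeff d (ExteriorAlgebra.ιMulti ℝ d (stdBasis d)) = 1 := by
    rw [topCoeff_ιMulti, Module.Basis.det_self]
  have hne : exteriorPower.ιMulti ℝ d (stdBasis d) ≠ 0 := fun h0 => by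
    have h2 : topCoeff d (exteriorPower.ιMulti ℝ d (stdBasis d)) = 0 := by rw [h0]; simp
    rw [exteriorPower.ιMulti_apply_coe, hb] at h2
    exact one_ne_zero h2
  obtain ⟨c, hc⟩ := (finrank_eq_one_iff_of_nonzero' _ hne).1 h1 ⟨a, ha⟩
  have hc' : a = c • ExteriorAlgebra.ιMulti ℝ d (stdBasis d) := by
    have := congrArg Subtype.val hc
    simpa using this.symm
  rw [hc', map_smul, hb] at h
  simp at h
  simp [hc', h]

/-- The element `w^n ∧ e` of the exterior algebra. -/
def topForm {V : Type*} [AddCommGroup V] [Module ℝ V] (n : ℕ) (w : ⋀[ℝ]^2 V) (e : V) :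
    ExteriorAlgebra ℝ V :=
  (w : ExteriorAlgebra ℝ V) ^ n * ExteriorAlgebra.ι ℝ e

theorem topForm_mem {V : Type*} [AddCommGroup V] [Module ℝ V] (n : ℕ) (w : ⋀[ℝ]^2 V) (e : V) :
    topForm n w e ∈ ⋀[ℝ]^(2 * n + 1) V := by
  refine SetLike.mul_mem_graded (A := fun i : ℕ => ⋀[ℝ]^i V) ?_ ?_
  · have := SetLike.pow_mem_graded (A := fun i : ℕ => ⋀[ℝ]^i V) n w.2
    simpa [mul_comm] using this
  · have h : ExteriorAlgebra.ι ℝ e ∈ LinearMap.range (ExteriorAlgebra.ι ℝ (M := V)) ^ 1 := by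
      rw [pow_one]
      exact LinearMap.mem_range_self _ e
    exact h

theorem coe_exteriorPower_map {V W : Type*} [AddCommGroup V] [Module ℝ V] [AddCommGroup W]
    [Module ℝ W] (T : V →ₗ[ℝ] W) (k : ℕ) (w : ⋀[ℝ]^k V) :
    (exteriorPower.map k T w : ExteriorAlgebra ℝ W) = ExteriorAlgebra.map T w := by
  have : (⋀[ℝ]^k W).subtype ∘ₗ exteriorPower.map k T =
      (ExteriorAlgebra.map T).toLinearMap ∘ₗ (⋀[ℝ]^k V).subtype := by
    apply exteriorPower.linearMap_ext
    ext v
    simp [ExteriorAlgebra.map_apply_ιMulti]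
  exact LinearMap.congr_fun this w

theorem map_topForm {V W : Type*} [AddCommGroup V] [Module ℝ V] [AddCommGroup W]
    [Module ℝ W] (T : V →ₗ[ℝ] W) (n : ℕ) (w : ⋀[ℝ]^2 V) (e : V) :
    ExteriorAlgebra.map T (topForm n w e) = topForm n (exteriorPower.map 2 T w) (T e) := by
  simp [topForm, coe_exteriorPower_map]

/-- The coefficient of `w^n ∧ e` in the standard basis. -/
def topCoord {n : ℕ} (w : ⋀[ℝ]^2 (Model (2 * n + 1))) (e : Model (2 * n + 1)) : ℝ :=
  topCoeff (2 * n + 1) (topForm n w e)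

/-- An endomorphism acts on top degree by its determinant. This is the source of every relation
between Jacobians and singular points below. -/
theorem topCoord_map {n : ℕ} (T : Model (2 * n + 1) →ₗ[ℝ] Model (2 * n + 1))
    (w : ⋀[ℝ]^2 (Model (2 * n + 1))) (e : Model (2 * n + 1)) :
    topCoord (exteriorPower.map 2 T w) (T e) = LinearMap.det T * topCoord w e := by
  rw [topCoord, ← map_topForm, topCoeff_map _ (topForm_mem n w e), topCoord]

theorem topCoord_eq_zero_iff {n : ℕ} {w : ⋀[ℝ]^2 (Model (2 * n + 1))} {e : Model (2 * n + 1)} :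
    topCoord w e = 0 ↔ topForm n w e = 0 :=
  topCoeff_eq_zero_iff (topForm_mem n w e)

theorem topCoord_smul {n : ℕ} (w : ⋀[ℝ]^2 (Model (2 * n + 1))) (e : Model (2 * n + 1)) (s t : ℝ) :
    topCoord (s • w) (t • e) = s ^ n * t * topCoord w e := by
  simp [topCoord, topForm, smul_pow, smul_smul, mul_assoc, mul_left_comm]

theorem bivectorEval_map {V W : Type*} [AddCommGroup V] [Module ℝ V] [AddCommGroup W]
    [Module ℝ W] (T : V →ₗ[ℝ] W) (w : ⋀[ℝ]^2 V) (α β : Module.Dual ℝ W) :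
    bivectorEval (exteriorPower.map 2 T w) α β = bivectorEval w (α ∘ₗ T) (β ∘ₗ T) := by
  have : exteriorPower.alternatingMapToDual ℝ W 2 ![α, β] ∘ₗ exteriorPower.map 2 T =
      exteriorPower.alternatingMapToDual ℝ V 2 ![α ∘ₗ T, β ∘ₗ T] := by
    apply exteriorPower.linearMap_ext
    ext v
    simp [Matrix.det_fin_two]
  exact LinearMap.congr_fun this w

theorem bivectorEval_add_left {V : Type*} [AddCommGroup V] [Module ℝ V] (w : ⋀[ℝ]^2 V)
    (α α' β : Module.Dual ℝ V) :
    bivectorEval w (α + α') β = bivectorEval w α β + bivectorEval w α' β := by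
  have : exteriorPower.alternatingMapToDual ℝ V 2 ![α + α', β] =
      exteriorPower.alternatingMapToDual ℝ V 2 ![α, β] +
        exteriorPower.alternatingMapToDual ℝ V 2 ![α', β] := by
    apply exteriorPower.linearMap_ext
    ext v
    simp [Matrix.det_fin_two]
    ring
  exact LinearMap.congr_fun this w

theorem bivectorEval_smul_left {V : Type*} [AddCommGroup V] [Module ℝ V] (w : ⋀[ℝ]^2 V) (c : ℝ)
    (α β : Module.Dual ℝ V) :
    bivectorEval w (c • α) β = c * bivectorEval w α β := by
  have : exteriorPower.alternatingMapToDual ℝ V 2 ![c • α, β] =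
      c • exteriorPower.alternatingMapToDual ℝ V 2 ![α, β] := by
    apply exteriorPower.linearMap_ext
    ext v
    simp [Matrix.det_fin_two]
    ring
  exact LinearMap.congr_fun this w

theorem bivectorEval_swap {V : Type*} [AddCommGroup V] [Module ℝ V] (w : ⋀[ℝ]^2 V)
    (α β : Module.Dual ℝ V) : bivectorEval w α β = - bivectorEval w β α := by
  have : exteriorPower.alternatingMapToDual ℝ V 2 ![α, β] =
      -exteriorPower.alternatingMapToDual ℝ V 2 ![β, α] := by
    apply exteriorPower.linearMap_ext
    ext v
    simp [Matrix.det_fin_two]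
  exact LinearMap.congr_fun this w

/-- `bivectorEval w` as a bilinear form on covectors. -/
def bivectorForm {V : Type*} [AddCommGroup V] [Module ℝ V] (w : ⋀[ℝ]^2 V) :
    Module.Dual ℝ V →ₗ[ℝ] Module.Dual ℝ V →ₗ[ℝ] ℝ :=
  LinearMap.mk₂ ℝ (bivectorEval w) (bivectorEval_add_left w) (bivectorEval_smul_left w)
    (fun α β β' => by
      rw [bivectorEval_swap, bivectorEval_add_left, bivectorEval_swap w α, bivectorEval_swap w α]
      ring)
    (fun c α β => by
      rw [bivectorEval_swap, bivectorEval_smul_left, bivectorEval_swap w α, smul_eq_mul]; ring)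

@[simp]
theorem bivectorForm_apply {V : Type*} [AddCommGroup V] [Module ℝ V] (w : ⋀[ℝ]^2 V)
    (α β : Module.Dual ℝ V) : bivectorForm w α β = bivectorEval w α β := rfl

/-- The sum runs over ordered pairs and meets each basis bivector twice, hence the factor one half.
-/
theorem bivector_eq_sum {V ι : Type*} [AddCommGroup V] [Module ℝ V] [Fintype ι]
    (b : Module.Basis ι ℝ V) (w : ⋀[ℝ]^2 V) :
    w = (2⁻¹ : ℝ) • ∑ i, ∑ j, bivectorEval w (b.coord i) (b.coord j) •
      exteriorPower.ιMulti ℝ 2 ![b i, b j] := by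
  have : LinearMap.id = (2⁻¹ : ℝ) • ∑ i, ∑ j,
      (exteriorPower.alternatingMapToDual ℝ V 2 ![b.coord i, b.coord j]).smulRight
        (exteriorPower.ιMulti ℝ 2 ![b i, b j]) := by
    apply exteriorPower.linearMap_ext
    apply AlternatingMap.ext
    intro v
    have hv : v = ![v 0, v 1] := by ext i; fin_cases i <;> rfl
    have hsum : exteriorPower.ιMulti ℝ 2 ![v 0, v 1] =
        ∑ i, ∑ j, (b.coord i (v 0) * b.coord j (v 1)) • exteriorPower.ιMulti ℝ 2 ![b i, b j] := by
      have h0 := b.sum_repr (v 0)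
      have h1 := b.sum_repr (v 1)
      have u1 : ∀ x y : V, Function.update ![x, 0] 1 y = ![x, y] := fun x y => by
        ext i; fin_cases i <;> simp
      have u0 : ∀ x y : V, Function.update ![0, y] 0 x = ![x, y] := fun x y => by
        ext i; fin_cases i <;> simp
      have e1 : ∀ x : V, exteriorPower.ιMulti ℝ 2 ![x, v 1] =
          ∑ j, b.coord j (v 1) • exteriorPower.ιMulti ℝ 2 ![x, b j] := by
        intro x
        have := map_sum ((exteriorPower.ιMulti ℝ 2).toMultilinearMap.toLinearMap ![x, 0] 1)
          (fun j => b.repr (v 1) j • b j) Finset.univ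
        simpa [h1, u1] using this
      have e0 : ∀ y : V, exteriorPower.ιMulti ℝ 2 ![v 0, y] =
          ∑ i, b.coord i (v 0) • exteriorPower.ιMulti ℝ 2 ![b i, y] := by
        intro y
        have := map_sum ((exteriorPower.ιMulti ℝ 2).toMultilinearMap.toLinearMap ![0, y] 0)
          (fun j => b.repr (v 0) j • b j) Finset.univ
        simpa [h0, u0] using this
      rw [e0]
      refine Finset.sum_congr rfl fun i _ => ?_
      rw [e1, Finset.smul_sum]
      simp [smul_smul]
    -- The same expansion with the indices exchanged; averaging it with `hsum` turns the
    -- coefficients into 2 × 2 minors, which are the values of `bivectorEval`.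
    have hsum' : exteriorPower.ιMulti ℝ 2 ![v 0, v 1] =
        - ∑ i, ∑ j, (b.coord j (v 0) * b.coord i (v 1)) •
          exteriorPower.ιMulti ℝ 2 ![b i, b j] := by
      rw [hsum, Finset.sum_comm, ← Finset.sum_neg_distrib]
      refine Finset.sum_congr rfl fun i _ => ?_
      rw [← Finset.sum_neg_distrib]
      refine Finset.sum_congr rfl fun j _ => ?_
      have := (exteriorPower.ιMulti ℝ 2).map_swap ![b i, b j] (i := 0) (j := 1) (by simp)
      have h2 : (![b i, b j] ∘ Equiv.swap (0 : Fin 2) 1) = ![b j, b i] := by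
        ext i; fin_cases i <;> simp
      rw [h2] at this
      rw [this, smul_neg]
    have key : (2 : ℝ) • exteriorPower.ιMulti ℝ 2 v = ∑ i, ∑ j,
        (b.coord i (v 0) * b.coord j (v 1) - b.coord i (v 1) * b.coord j (v 0)) •
          exteriorPower.ιMulti ℝ 2 ![b i, b j] := by
      conv_lhs => rw [hv, two_smul]
      nth_rewrite 1 [hsum]
      rw [hsum', ← sub_eq_add_neg]
      simp only [← Finset.sum_sub_distrib]
      refine Finset.sum_congr rfl fun i _ => Finset.sum_congr rfl fun j _ => ?_
      rw [mul_comm (b.coord i (v 1))]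
      exact (sub_smul _ _ _).symm
    have : exteriorPower.ιMulti ℝ 2 v = (2⁻¹ : ℝ) • (2 : ℝ) • exteriorPower.ιMulti ℝ 2 v := by
      rw [smul_smul]; norm_num
    rw [LinearMap.compAlternatingMap_apply, LinearMap.compAlternatingMap_apply, LinearMap.id_apply]
    conv_lhs => rw [this, key]
    simp only [LinearMap.smul_apply, LinearMap.sum_apply, LinearMap.smulRight_apply]
    congr 1
    refine Finset.sum_congr rfl fun i _ => Finset.sum_congr rfl fun j _ => ?_
    congr 1
    rw [hv]
    simp [Matrix.det_fin_two]
    ring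
  have h := LinearMap.congr_fun this w
  simpa [bivectorEval] using h

theorem bivector_ext {V ι : Type*} [AddCommGroup V] [Module ℝ V] [Fintype ι]
    (b : Module.Basis ι ℝ V) {w w' : ⋀[ℝ]^2 V}
    (h : ∀ i j, bivectorEval w (b.coord i) (b.coord j) = bivectorEval w' (b.coord i) (b.coord j)) :
    w = w' := by
  rw [bivector_eq_sum b w, bivector_eq_sum b w']
  simp [h]

/-- A covector `β ≠ 0` that annihilates `e` and is in the radical of `w` forces `w^n ∧ e = 0`. -/
theorem topCoord_eq_zero_of_radical {n : ℕ} (w : ⋀[ℝ]^2 (Model (2 * n + 1)))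
    (e : Model (2 * n + 1)) (β : Module.Dual ℝ (Model (2 * n + 1))) (hβ : β ≠ 0) (he : β e = 0)
    (hw : ∀ α, bivectorEval w α β = 0) : topCoord w e = 0 := by
  obtain ⟨v, hv⟩ : ∃ v, β v = 1 := by
    obtain ⟨v, hv⟩ : ∃ v, β v ≠ 0 := by
      by_contra! h
      exact hβ (LinearMap.ext h)
    exact ⟨(β v)⁻¹ • v, by simp [hv]⟩
  -- `T` projects onto `ker β` along `v`. It fixes `w` because `β` is radical and fixes `e` because
  -- `β e = 0`, yet its determinant is 0, so `topCoord_map` concludes.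
  set T : Model (2 * n + 1) →ₗ[ℝ] Model (2 * n + 1) := LinearMap.id - β.smulRight v with hT
  have hTv : T v = 0 := by simp [hT, hv]
  have hcomp : ∀ α : Module.Dual ℝ (Model (2 * n + 1)), α ∘ₗ T = α + (-(α v)) • β := by
    intro α; ext x; simp [hT]; ring
  have h1 : exteriorPower.map 2 T w = w := by
    refine bivector_ext (stdBasis _) fun i j => ?_
    rw [bivectorEval_map, hcomp, hcomp, bivectorEval_add_left, bivectorEval_smul_left,
      bivectorEval_swap, bivectorEval_add_left, bivectorEval_smul_left, bivectorEval_swap w β,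
      bivectorEval_swap w β, hw, bivectorEval_swap w ((stdBasis (2 * n + 1)).coord j),
      bivectorEval_add_left, bivectorEval_smul_left, hw, hw]
    ring
  have h2 : T e = e := by simp [hT, he]
  have h3 : LinearMap.det T = 0 := by
    by_contra h
    have hinj := ((LinearMap.equivOfDetNeZero T h).injective)
    have hv0 : v = 0 := hinj (by simpa using hTv)
    simp [hv0] at hv
  have := topCoord_map T w e
  rwa [h1, h2, h3, zero_mul] at this

/-- If `w^n ∧ e ≠ 0`, no linear endomorphism `T` that is injective on `ker β`, with `β ≠ 0` and
`β e = 0`, can satisfy `w(α ∘ T, β) = 0` for all `α`. -/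
theorem topCoord_eq_zero_of_injOn {n : ℕ} (w : ⋀[ℝ]^2 (Model (2 * n + 1)))
    (e : Model (2 * n + 1)) (β : Module.Dual ℝ (Model (2 * n + 1))) (hβ : β ≠ 0) (he : β e = 0)
    (T : Model (2 * n + 1) →ₗ[ℝ] Model (2 * n + 1)) (hT : ∀ x, β x = 0 → T x = 0 → x = 0)
    (hw : ∀ α : Module.Dual ℝ (Model (2 * n + 1)), bivectorEval w (α ∘ₗ T) β = 0) :
    topCoord w e = 0 := by
  refine topCoord_eq_zero_of_radical w e β hβ he fun γ => ?_
  obtain ⟨v, hv⟩ : ∃ v, β v = 1 := by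
    obtain ⟨v, hv⟩ : ∃ v, β v ≠ 0 := by
      by_contra! h
      exact hβ (LinearMap.ext h)
    exact ⟨(β v)⁻¹ • v, by simp [hv]⟩
  have hker : LinearMap.ker (T ∘ₗ (LinearMap.ker β).subtype) = ⊥ := by
    rw [LinearMap.ker_eq_bot']
    rintro ⟨x, hx⟩ h
    simpa using hT x hx (by simpa using h)
  obtain ⟨g, hg⟩ := LinearMap.exists_leftInverse_of_injective _ hker
  set α : Module.Dual ℝ (Model (2 * n + 1)) := γ ∘ₗ (LinearMap.ker β).subtype ∘ₗ g
  have hα : ∀ x, β x = 0 → α (T x) = γ x := by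
    intro x hx
    have := LinearMap.congr_fun hg ⟨x, hx⟩
    simp only [LinearMap.comp_apply, Submodule.subtype_apply, LinearMap.id_apply] at this
    simp [α, this]
  -- On `ker β` every covector factors through `T` by injectivity, so it differs from some `α ∘ T`
  -- by a multiple of `β`, which pairs to zero with `β`.
  have hγ : γ = α ∘ₗ T + (γ v - α (T v)) • β := by
    ext x
    have := hα (x - β x • v) (by simp [hv])
    simp only [map_sub, map_smul, smul_eq_mul] at this
    simp
    linarith
  have hββ : bivectorEval w β β = 0 := by
    have := bivectorEval_swap w β β
    linarith
  rw [hγ, bivectorEval_add_left, bivectorEval_smul_left, hw, hββ]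
  ring

/-! ### Continuity of the top coefficient, tested by linear functionals. -/

instance {d : ℕ} : Module.Finite ℝ (ExteriorAlgebra ℝ (Model d)) :=
  Module.Finite.of_basis (stdBasis d).ExteriorAlgebra

/-- Coefficientwise continuity is preserved by products in a finite-dimensional algebra. -/
theorem continuousWithinAt_linear_mul {A X : Type*} [Ring A] [Algebra ℝ A] [Module.Finite ℝ A]
    [TopologicalSpace X] {s : Set X} {x : X} {a b : X → A}
    (ha : ∀ ℓ : A →ₗ[ℝ] ℝ, ContinuousWithinAt (fun y => ℓ (a y)) s x)
    (hb : ∀ ℓ : A →ₗ[ℝ] ℝ, ContinuousWithinAt (fun y => ℓ (b y)) s x) (ℓ : A →ₗ[ℝ] ℝ) :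
    ContinuousWithinAt (fun y => ℓ (a y * b y)) s x := by
  set B := Module.finBasis ℝ A
  have : (fun y => ℓ (a y * b y)) =
      fun y => ∑ i, ∑ j, B.coord i (a y) * (B.coord j (b y) * ℓ (B i * B j)) := by
    funext y
    conv_lhs => rw [← B.sum_repr (a y), ← B.sum_repr (b y), Finset.sum_mul_sum]
    simp [mul_left_comm]
  rw [this]
  exact tendsto_finsetSum _ fun i _ => tendsto_finsetSum _ fun j _ =>
    (ha _).mul ((hb _).mul continuousWithinAt_const)

theorem continuousWithinAt_topCoord {X : Type*} [TopologicalSpace X] {s : Set X} {x : X} {n : ℕ}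
    {w : X → ⋀[ℝ]^2 (Model (2 * n + 1))} {e : X → Model (2 * n + 1)}
    (hw : ∀ i j, ContinuousWithinAt
      (fun y => bivectorEval (w y) ((stdBasis _).coord i) ((stdBasis _).coord j)) s x)
    (he : ContinuousWithinAt e s x) :
    ContinuousWithinAt (fun y => topCoord (w y) (e y)) s x := by
  refine continuousWithinAt_linear_mul ?_ ?_ _
  · have hw' : ∀ ℓ : ExteriorAlgebra ℝ (Model (2 * n + 1)) →ₗ[ℝ] ℝ,
        ContinuousWithinAt (fun y => ℓ (w y)) s x := by
      intro ℓ
      have : (fun y => ℓ (w y)) = fun y => (2⁻¹ : ℝ) * ∑ i, ∑ j,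
          bivectorEval (w y) ((stdBasis _).coord i) ((stdBasis _).coord j) *
            ℓ (exteriorPower.ιMulti ℝ 2 ![stdBasis _ i, stdBasis _ j]) := by
        funext y
        conv_lhs => rw [bivector_eq_sum (stdBasis _) (w y)]
        simp
      rw [this]
      exact continuousWithinAt_const.mul (tendsto_finsetSum _ fun i _ =>
        tendsto_finsetSum _ fun j _ => (hw i j).mul continuousWithinAt_const)
    intro ℓ
    have hp : ∀ k : ℕ, ∀ ℓ : ExteriorAlgebra ℝ (Model (2 * n + 1)) →ₗ[ℝ] ℝ,
        ContinuousWithinAt (fun y => ℓ ((w y : ExteriorAlgebra ℝ (Model (2 * n + 1))) ^ k)) s x := by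
      intro k
      induction k with
      | zero => intro ℓ; simpa using continuousWithinAt_const
      | succ k ih =>
        intro ℓ
        simp only [pow_succ]
        exact continuousWithinAt_linear_mul ih hw' ℓ
    exact hp n ℓ
  · intro ℓ
    exact ((ℓ ∘ₗ ExteriorAlgebra.ι ℝ).continuous_of_finiteDimensional.continuousAt
      (x := e x)).comp_continuousWithinAt he

/-! ### Derivatives of determinants and Jacobians. -/

section Determinant

variable {E : Type*} [NormedAddCommGroup E] [NormedSpace ℝ E] [FiniteDimensional ℝ E]

theorem contDiff_det {r : WithTop ℕ∞} : ContDiff ℝ r (fun T : E →L[ℝ] E => T.det) := by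
  set b := Module.finBasis ℝ E
  have h : (fun T : E →L[ℝ] E => T.det) =
      fun T : E →L[ℝ] E => ∑ σ : Equiv.Perm (Fin (Module.finrank ℝ E)), (Equiv.Perm.sign σ : ℝ) *
        ∏ i, LinearMap.toMatrix b b (T : E →ₗ[ℝ] E) (σ i) i := by
    funext T
    rw [ContinuousLinearMap.det, ← LinearMap.det_toMatrix b, Matrix.det_apply']
  rw [h]
  refine ContDiff.sum fun σ _ => contDiff_const.mul (contDiff_prod fun i _ => ?_)
  have : (fun T : E →L[ℝ] E => LinearMap.toMatrix b b (T : E →ₗ[ℝ] E) (σ i) i) =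
      fun T => LinearMap.toContinuousLinearMap (b.coord (σ i)) (T (b i)) := by
    funext T
    simp [LinearMap.toMatrix_apply]
  rw [this]
  exact (ContinuousLinearMap.contDiff _).comp (contDiff_id.clm_apply contDiff_const)

/-- In a basis, `det(1 + tB)` is a polynomial in `t` whose linear coefficient is the trace. -/
theorem hasDerivAt_det_one_add_smul (B : E →L[ℝ] E) :
    HasDerivAt (fun t : ℝ => (ContinuousLinearMap.id ℝ E + t • B).det)
      (LinearMap.trace ℝ E (B : E →ₗ[ℝ] E)) 0 := by
  set b := Module.finBasis ℝ E
  set M := LinearMap.toMatrix b b (B : E →ₗ[ℝ] E)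
  set p : Polynomial ℝ := Matrix.det (1 + (Polynomial.X : Polynomial ℝ) • M.map Polynomial.C)
  have h : (fun t : ℝ => (ContinuousLinearMap.id ℝ E + t • B).det) = fun t => p.eval t := by
    funext t
    rw [ContinuousLinearMap.det, ← LinearMap.det_toMatrix b]
    simp only [p]
    rw [← Polynomial.coe_evalRingHom, RingHom.map_det]
    congr 1
    ext i j
    simp [M, LinearMap.toMatrix_apply, Matrix.one_apply, Polynomial.eval_add,
      apply_ite (Polynomial.eval t), Finsupp.single_apply, eq_comm]
    exact mul_comm _ _
  rw [h, LinearMap.trace_eq_matrix_trace ℝ b, ← Matrix.derivative_det_one_add_X_smul]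
  exact p.hasDerivAt 0

/-- Differentiate `det` along the curve `(1 + tB) F (1 - tA)`, where it is a product of
determinants. No invertibility of `F` enters, which matters because the formula is used at critical
points. -/
theorem fderiv_det_apply_mul_sub_mul (F A B : E →L[ℝ] E) :
    fderiv ℝ (fun T : E →L[ℝ] E => T.det) F (B.comp F - F.comp A) =
      (LinearMap.trace ℝ E (B : E →ₗ[ℝ] E) - LinearMap.trace ℝ E (A : E →ₗ[ℝ] E)) * F.det := by
  set c : ℝ → E →L[ℝ] E := fun t =>
    ((ContinuousLinearMap.id ℝ E + t • B).comp F).comp (ContinuousLinearMap.id ℝ E + t • (-A))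
  have hline : ∀ C : E →L[ℝ] E,
      HasDerivAt (fun t : ℝ => ContinuousLinearMap.id ℝ E + t • C) C 0 := fun C => by
    simpa using ((hasDerivAt_id (0 : ℝ)).smul_const C).const_add (ContinuousLinearMap.id ℝ E)
  have hc : HasDerivAt c (B.comp F - F.comp A) 0 := by
    have h := ((hline B).clm_comp (hasDerivAt_const (0 : ℝ) F)).clm_comp (hline (-A))
    convert h using 1
    ext x
    simp [sub_eq_add_neg]
  have hc0 : c 0 = F := by ext x; simp [c]
  have h1 : HasDerivAt (fun t => (c t).det)
      (fderiv ℝ (fun T : E →L[ℝ] E => T.det) F (B.comp F - F.comp A)) 0 := by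
    have hd := ((contDiff_det (E := E) (r := 1)).differentiable one_ne_zero F).hasFDerivAt
    rw [← hc0] at hd
    have := hd.comp_hasDerivAt (0 : ℝ) hc
    rwa [hc0] at this
  have h2 : HasDerivAt (fun t => (c t).det)
      ((LinearMap.trace ℝ E (B : E →ₗ[ℝ] E) - LinearMap.trace ℝ E (A : E →ₗ[ℝ] E)) * F.det) 0 := by
    have hdet : (fun t => (c t).det) = fun t => (ContinuousLinearMap.id ℝ E + t • B).det * F.det *
        (ContinuousLinearMap.id ℝ E + t • (-A)).det := by
      funext t
      simp only [c, ContinuousLinearMap.det, ContinuousLinearMap.toLinearMap_comp, LinearMap.det_comp]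
    rw [hdet]
    have h := ((hasDerivAt_det_one_add_smul B).mul_const F.det).mul
      (hasDerivAt_det_one_add_smul (-A))
    have e1 : (ContinuousLinearMap.id ℝ E).det = 1 := by
      simp [ContinuousLinearMap.det]
    refine h.congr_deriv ?_
    simp only [zero_smul, add_zero, e1, ContinuousLinearMap.toLinearMap_neg, map_neg]
    ring
  exact h1.unique h2

/-- The Jacobian determinant `J` of a map `F` between `F`-related vector fields `X`, `Y` satisfies
`X(J) = (div Y ∘ F - div X) J`. -/
theorem fderiv_jacobian_of_related {F X Y : E → E} {y : E} (hF : ContDiffAt ℝ 2 F y)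
    (hX : DifferentiableAt ℝ X y) (hY : DifferentiableAt ℝ Y (F y))
    (h : ∀ᶠ z in 𝓝 y, fderiv ℝ F z (X z) = Y (F z)) :
    fderiv ℝ (fun z => (fderiv ℝ F z).det) y (X y) =
      (LinearMap.trace ℝ E (fderiv ℝ Y (F y) : E →ₗ[ℝ] E) -
        LinearMap.trace ℝ E (fderiv ℝ X y : E →ₗ[ℝ] E)) * (fderiv ℝ F y).det := by
  have hF' : DifferentiableAt ℝ (fderiv ℝ F) y :=
    (hF.fderiv_right (m := 1) (by norm_num)).differentiableAt one_ne_zero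
  have hFd : DifferentiableAt ℝ F y := hF.differentiableAt two_ne_zero
  have h1 : fderiv ℝ (fun z => (fderiv ℝ F z).det) y =
      (fderiv ℝ (fun T : E →L[ℝ] E => T.det) (fderiv ℝ F y)).comp (fderiv ℝ (fderiv ℝ F) y) :=
    fderiv_comp (g := fun T : E →L[ℝ] E => T.det) y
      ((contDiff_det (r := 1)).differentiable one_ne_zero _) hF'
  -- Differentiating `DF(X) = Y ∘ F` in the direction `v` and using the symmetry of `D²F` expresses
  -- the derivative of `DF` along `X` as `DY ∘ DF - DF ∘ DX`.
  have h2 : ∀ v, fderiv ℝ (fderiv ℝ F) y (X y) v =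
      fderiv ℝ Y (F y) (fderiv ℝ F y v) - fderiv ℝ F y (fderiv ℝ X y v) := by
    intro v
    have hs : fderiv ℝ (fderiv ℝ F) y (X y) v = fderiv ℝ (fderiv ℝ F) y v (X y) :=
      (hF.isSymmSndFDerivAt (by simp)) (X y) v
    have e1 : fderiv ℝ (fun z => fderiv ℝ F z (X z)) y v =
        fderiv ℝ (fun z => Y (F z)) y v := by
      rw [Filter.EventuallyEq.fderiv_eq h]
    rw [fderiv_clm_apply hF' hX] at e1
    have e2 : fderiv ℝ (fun z => Y (F z)) y = (fderiv ℝ Y (F y)).comp (fderiv ℝ F y) :=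
      fderiv_comp y hY hFd
    rw [e2] at e1
    simp at e1
    rw [hs, ← e1]
    abel
  have h3 : fderiv ℝ (fderiv ℝ F) y (X y) =
      (fderiv ℝ Y (F y)).comp (fderiv ℝ F y) - (fderiv ℝ F y).comp (fderiv ℝ X y) := by
    ext v
    simp [h2]
  rw [h1, ContinuousLinearMap.comp_apply, h3, fderiv_det_apply_mul_sub_mul]

end Determinant

/-! ### Volume estimate and the impossibility of covering a punctured ball. -/

section Measure

open MeasureTheory Filter

variable {E : Type*} [NormedAddCommGroup E] [NormedSpace ℝ E] [FiniteDimensional ℝ E]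
  [MeasurableSpace E] [BorelSpace E] (μ : Measure E) [μ.IsAddHaarMeasure]

/-- If `|det DF| ≤ C ‖F‖ ^ d` on a set `U` of finite measure, then the image under `F` of the set
where `0 < ‖F‖ < ρ` has measure `o(ρ ^ d)`. -/
theorem eventually_measure_image_le {F : E → E} {U : Set E} (hU : IsOpen U) (hμU : μ U ≠ ⊤)
    (hF : DifferentiableOn ℝ F U) (d : ℕ) {C : ℝ} (hC : 0 ≤ C)
    (hJ : ∀ y ∈ U, |(fderiv ℝ F y).det| ≤ C * ‖F y‖ ^ d) {ε : ENNReal} (hε : 0 < ε) :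
    ∀ᶠ k : ℕ in atTop,
      μ (F '' {y ∈ U | F y ≠ 0 ∧ ‖F y‖ < 1 / ((k : ℝ) + 1)}) ≤
        ε * ENNReal.ofReal ((1 / ((k : ℝ) + 1)) ^ d) := by
  set S : ℕ → Set E := fun k => {y ∈ U | F y ≠ 0 ∧ ‖F y‖ < 1 / ((k : ℝ) + 1)} with hS
  have hSopen : ∀ k, IsOpen (S k) := by
    intro k
    have h1 := hF.continuousOn.isOpen_inter_preimage hU (isOpen_compl_singleton (x := (0 : E)))
    have h2 := hF.continuousOn.isOpen_inter_preimage hU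
      (Metric.isOpen_ball (x := (0 : E)) (ε := 1 / ((k : ℝ) + 1)))
    convert h1.inter h2 using 1
    ext y
    simp [hS]
  have hanti : Antitone S := by
    intro k l hkl y hy
    refine ⟨hy.1, hy.2.1, hy.2.2.trans_le ?_⟩
    exact one_div_le_one_div_of_le (by positivity) (by exact_mod_cast Nat.succ_le_succ hkl)
  -- Excluding the zeros of `F` makes these sets shrink to the empty set, so `μ (S k)` tends to 0;
  -- this improves `O(ρ ^ d)` to `o(ρ ^ d)`.
  have hinter : ⋂ k, S k = ∅ := by
    ext y
    simp only [Set.mem_iInter, Set.mem_empty_iff_false, iff_false]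
    intro h
    obtain ⟨k, hk⟩ := exists_nat_one_div_lt (norm_pos_iff.2 (h 0).2.1)
    exact absurd (h k).2.2 (not_lt.2 hk.le)
  have hlim : Tendsto (fun k => ENNReal.ofReal C * μ (S k)) atTop (𝓝 0) := by
    have h := tendsto_measure_iInter_atTop (μ := μ) (s := S)
      (fun k => (hSopen k).measurableSet.nullMeasurableSet) hanti
      ⟨0, ne_top_of_le_ne_top hμU (measure_mono fun y hy => hy.1)⟩
    rw [hinter, measure_empty] at h
    simpa using ENNReal.Tendsto.const_mul h (Or.inr ENNReal.ofReal_ne_top)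
  filter_upwards [hlim.eventually_lt_const hε] with k hk
  have hρ : (0 : ℝ) ≤ 1 / ((k : ℝ) + 1) := by positivity
  calc μ (F '' S k)
      ≤ ∫⁻ y in S k, ENNReal.ofReal |(fderiv ℝ F y).det| ∂μ :=
        addHaar_image_le_lintegral_abs_det_fderiv μ (hSopen k).measurableSet fun y hy =>
          ((hF y hy.1).differentiableAt (hU.mem_nhds hy.1)).hasFDerivAt.hasFDerivWithinAt
    _ ≤ ∫⁻ _ in S k, ENNReal.ofReal (C * (1 / ((k : ℝ) + 1)) ^ d) ∂μ := by
        refine setLIntegral_mono' (hSopen k).measurableSet fun y hy => ?_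
        refine ENNReal.ofReal_le_ofReal ((hJ y hy.1).trans ?_)
        exact mul_le_mul_of_nonneg_left
          (pow_le_pow_left₀ (norm_nonneg _) hy.2.2.le d) hC
    _ = ENNReal.ofReal C * μ (S k) * ENNReal.ofReal ((1 / ((k : ℝ) + 1)) ^ d) := by
        rw [setLIntegral_const, ENNReal.ofReal_mul hC]
        ring
    _ ≤ ε * ENNReal.ofReal ((1 / ((k : ℝ) + 1)) ^ d) := by gcongr

/-- The images of finitely many maps with `|det DF| ≤ C ‖F‖ ^ dim E` cannot cover a punctured
neighbourhood of `0`. -/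
theorem not_punctured_ball_subset_iUnion_image [Nontrivial E] {ι : Type*} (t : Finset ι)
    (F : ι → E → E) (U : ι → Set E) (hU : ∀ i ∈ t, IsOpen (U i)) (hμU : ∀ i ∈ t, μ (U i) ≠ ⊤)
    (hF : ∀ i ∈ t, DifferentiableOn ℝ (F i) (U i))
    (hJ : ∀ i ∈ t, ∃ C : ℝ, 0 ≤ C ∧
      ∀ y ∈ U i, |(fderiv ℝ (F i) y).det| ≤ C * ‖F i y‖ ^ Module.finrank ℝ E)
    {ρ : ℝ} (hρ : 0 < ρ) : ¬ ∀ x : E, x ≠ 0 → ‖x‖ < ρ → ∃ i ∈ t, ∃ y ∈ U i, F i y = x := by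
  intro hcov
  set m := μ (Metric.ball (0 : E) 1)
  have hm0 : m ≠ 0 := (Metric.measure_ball_pos μ _ one_pos).ne'
  have hmt : m ≠ ⊤ := measure_ball_lt_top.ne
  -- Small enough that `t.card` shares stay below the unit-ball volume `m`; the `+ 1` keeps the
  -- denominator nonzero when `t` is empty.
  set ε : ENNReal := m / (2 * (t.card + 1))
  have hε : 0 < ε := by
    refine ENNReal.div_pos hm0 ?_
    exact ENNReal.mul_ne_top (by simp) (by simp)
  have hev : ∀ᶠ k : ℕ in atTop, ∀ i ∈ t,
      μ (F i '' {y ∈ U i | F i y ≠ 0 ∧ ‖F i y‖ < 1 / ((k : ℝ) + 1)}) ≤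
        ε * ENNReal.ofReal ((1 / ((k : ℝ) + 1)) ^ Module.finrank ℝ E) := by
    rw [eventually_all_finset]
    intro i hi
    obtain ⟨C, hC, hCJ⟩ := hJ i hi
    exact eventually_measure_image_le μ (hU i hi) (hμU i hi) (hF i hi) _ hC hCJ hε
  obtain ⟨k, hk, hkρ⟩ := (hev.and
    (tendsto_one_div_add_atTop_nhds_zero_nat.eventually_lt_const hρ)).exists
  have hρk : (0 : ℝ) < 1 / ((k : ℝ) + 1) := by positivity
  set q := ENNReal.ofReal ((1 / ((k : ℝ) + 1)) ^ Module.finrank ℝ E)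
  have hq0 : q ≠ 0 := by simp only [q, ne_eq, ENNReal.ofReal_eq_zero, not_le]; positivity
  have hqt : q ≠ ⊤ := ENNReal.ofReal_ne_top
  have h1 : q * m ≤ t.card * (ε * q) := by
    calc q * m = μ (Metric.ball (0 : E) (1 / ((k : ℝ) + 1))) :=
          (Measure.addHaar_ball_of_pos μ 0 hρk).symm
      _ = μ (Metric.ball (0 : E) (1 / ((k : ℝ) + 1)) \ {0}) :=
          (measure_sdiff_null (measure_singleton _)).symm
      _ ≤ μ (⋃ i ∈ t, F i '' {y ∈ U i | F i y ≠ 0 ∧ ‖F i y‖ < 1 / ((k : ℝ) + 1)}) := by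
          refine measure_mono fun x hx => ?_
          have hx1 : ‖x‖ < 1 / ((k : ℝ) + 1) := by simpa using hx.1
          obtain ⟨i, hi, y, hy, rfl⟩ := hcov x hx.2 (hx1.trans hkρ)
          exact Set.mem_iUnion₂.2 ⟨i, hi, y, ⟨hy, hx.2, hx1⟩, rfl⟩
      _ ≤ ∑ i ∈ t, μ (F i '' {y ∈ U i | F i y ≠ 0 ∧ ‖F i y‖ < 1 / ((k : ℝ) + 1)}) :=
          measure_biUnion_finset_le _ _
      _ ≤ ∑ _i ∈ t, ε * q := Finset.sum_le_sum hk
      _ = t.card * (ε * q) := by simp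
  have h2 : m ≤ t.card * ε := by
    have : q * m ≤ q * (t.card * ε) := by
      calc q * m ≤ t.card * (ε * q) := h1
        _ = q * (t.card * ε) := by ring
    exact (ENNReal.mul_le_mul_iff_right hq0 hqt).1 this
  have h3 : (t.card : ENNReal) * ε < m := by
    have h4 : (2 * ((t.card : ENNReal) + 1)) * ε = m :=
      ENNReal.mul_div_cancel (by simp) (ENNReal.mul_ne_top (by simp) (by simp))
    have hεt : ε ≠ ⊤ := fun h => by
      rw [h, ENNReal.mul_top (by simp)] at h4
      exact hmt h4.symm
    rw [← h4]
    refine ENNReal.mul_lt_mul_left hε.ne' hεt ?_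
    norm_cast
    omega
  exact absurd h2 (not_le.2 h3)

end Measure

/-! ### Ideals generated by the iterated derivatives of a function. -/

section Jets

variable {E ι : Type*} [NormedAddCommGroup E] [NormedSpace ℝ E]
  (b : Module.Basis ι ℝ E)

/-- Iterated directional derivatives along basis vectors. -/
def iterDir (J : E → ℝ) : List ι → E → ℝ
  | [] => J
  | i :: l => fun y => fderiv ℝ (iterDir J l) y (b i)

/-- The ideal of smooth functions on `Ω` generated by the iterated derivatives of `J` of order at
most `k`. -/
inductive JetIdeal (Ω : Set E) (J : E → ℝ) (k : ℕ) : (E → ℝ) → Prop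
  | gen (l : List ι) (hl : l.length ≤ k) : JetIdeal Ω J k (iterDir b J l)
  | mul (c g : E → ℝ) (hc : ContDiffOn ℝ ∞ c Ω) (hg : JetIdeal Ω J k g) :
      JetIdeal Ω J k (fun y => c y * g y)
  | add (g g' : E → ℝ) (hg : JetIdeal Ω J k g) (hg' : JetIdeal Ω J k g') :
      JetIdeal Ω J k (fun y => g y + g' y)
  | congr (g g' : E → ℝ) (hg : JetIdeal Ω J k g) (h : Set.EqOn g g' Ω) : JetIdeal Ω J k g'

variable {b} {Ω : Set E} {J : E → ℝ}

theorem contDiffOn_fderiv_apply {g : E → ℝ} {X : E → E} (hΩ : IsOpen Ω)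
    (hg : ContDiffOn ℝ ∞ g Ω) (hX : ContDiffOn ℝ ∞ X Ω) :
    ContDiffOn ℝ ∞ (fun y => fderiv ℝ g y (X y)) Ω :=
  (hg.fderiv_of_isOpen hΩ (m := ∞) (by simp)).clm_apply hX

theorem contDiffOn_iterDir (hΩ : IsOpen Ω) (hJ : ContDiffOn ℝ ∞ J Ω) (l : List ι) :
    ContDiffOn ℝ ∞ (iterDir b J l) Ω := by
  induction l with
  | nil => exact hJ
  | cons i l ih => exact contDiffOn_fderiv_apply hΩ ih contDiffOn_const

theorem differentiableAt_of_contDiffOn {F : Type*} [NormedAddCommGroup F] [NormedSpace ℝ F]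
    {g : E → F} (hΩ : IsOpen Ω) (hg : ContDiffOn ℝ ∞ g Ω) {y : E} (hy : y ∈ Ω) :
    DifferentiableAt ℝ g y :=
  (hg.contDiffAt (hΩ.mem_nhds hy)).differentiableAt (by simp)

namespace JetIdeal

variable {k : ℕ} {g : E → ℝ}

theorem contDiffOn (hΩ : IsOpen Ω) (hJ : ContDiffOn ℝ ∞ J Ω) (h : JetIdeal b Ω J k g) :
    ContDiffOn ℝ ∞ g Ω := by
  induction h with
  | gen l hl => exact contDiffOn_iterDir hΩ hJ l
  | mul c g hc _ ih => exact hc.mul ih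
  | add g g' _ _ ih ih' => exact ih.add ih'
  | congr g g' _ h ih => exact ih.congr fun y hy => (h hy).symm

theorem mono {k' : ℕ} (hk : k ≤ k') (h : JetIdeal b Ω J k g) : JetIdeal b Ω J k' g := by
  induction h with
  | gen l hl => exact gen l (hl.trans hk)
  | mul c g hc _ ih => exact mul c g hc ih
  | add g g' _ _ ih ih' => exact add g g' ih ih'
  | congr g g' _ h ih => exact congr g g' ih h

/-- This is how membership is exploited: at a point where `J` vanishes to order `k`, every element
of the ideal vanishes. -/
theorem eq_zero (h : JetIdeal b Ω J k g) {y : E} (hy : y ∈ Ω)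
    (h0 : ∀ l : List ι, l.length ≤ k → iterDir b J l y = 0) : g y = 0 := by
  induction h with
  | gen l hl => exact h0 l hl
  | mul c g hc _ ih => simp [ih]
  | add g g' _ _ ih ih' => simp [ih, ih']
  | congr g g' _ h ih => rw [← h hy, ih]

theorem sum {κ : Type*} (s : Finset κ) (f : κ → E → ℝ)
    (h : ∀ i ∈ s, JetIdeal b Ω J k (f i)) : JetIdeal b Ω J k (fun y => ∑ i ∈ s, f i y) := by
  classical
  induction s using Finset.induction_on with
  | empty =>
    refine congr _ _ (mul (fun _ => 0) _ contDiffOn_const (gen (b := b) [] (Nat.zero_le k))) ?_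
    intro y _
    simp
  | insert i s hi ih =>
    refine congr _ _ (add _ _ (h i (Finset.mem_insert_self i s))
      (ih fun j hj => h j (Finset.mem_insert_of_mem hj))) ?_
    intro y _
    simp [Finset.sum_insert hi]

theorem fderiv_basis (hΩ : IsOpen Ω) (hJ : ContDiffOn ℝ ∞ J Ω) (h : JetIdeal b Ω J k g) (i : ι) :
    JetIdeal b Ω J (k + 1) (fun y => fderiv ℝ g y (b i)) := by
  induction h with
  | gen l hl => exact gen (i :: l) (by simpa using hl)
  | mul c g hc hg ih =>
    refine congr _ _ (add _ _ (mul c _ hc ih) (mul (fun y => fderiv ℝ c y (b i)) g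
      (contDiffOn_fderiv_apply hΩ hc contDiffOn_const) (hg.mono (Nat.le_succ k)))) ?_
    intro y hy
    beta_reduce
    rw [fderiv_fun_mul (differentiableAt_of_contDiffOn hΩ hc hy)
      (differentiableAt_of_contDiffOn hΩ (hg.contDiffOn hΩ hJ) hy)]
    simp [mul_comm]
  | add g g' hg hg' ih ih' =>
    refine congr _ _ (add _ _ ih ih') ?_
    intro y hy
    beta_reduce
    rw [fderiv_fun_add (differentiableAt_of_contDiffOn hΩ (hg.contDiffOn hΩ hJ) hy)
      (differentiableAt_of_contDiffOn hΩ (hg'.contDiffOn hΩ hJ) hy)]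
    simp
  | congr g g' _ h ih =>
    refine congr _ _ ih ?_
    intro y hy
    have : g =ᶠ[𝓝 y] g' := Filter.eventuallyEq_of_mem (hΩ.mem_nhds hy) h
    simp only [this.fderiv_eq]

/-- A vector field `X` with `X(J) = h J` preserves the jet ideals of `J`. -/
theorem fderiv_field [Fintype ι] (hΩ : IsOpen Ω) (hJ : ContDiffOn ℝ ∞ J Ω) {X : E → E}
    (hX : ContDiffOn ℝ ∞ X Ω) {c : E → ℝ} (hc : ContDiffOn ℝ ∞ c Ω)
    (hXJ : ∀ y ∈ Ω, fderiv ℝ J y (X y) = c y * J y) (h : JetIdeal b Ω J k g) :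
    JetIdeal b Ω J k (fun y => fderiv ℝ g y (X y)) := by
  have hb : FiniteDimensional ℝ E := b.finiteDimensional_of_finite
  induction h with
  | gen l hl =>
    -- The induction on `l` needs the sharp order `l.length`, since each basis derivative raises the
    -- order by one.
    refine JetIdeal.mono (k := l.length) hl ?_
    clear hl
    induction l with
    | nil =>
      refine congr _ _ (mul c J hc (gen (b := b) [] le_rfl)) ?_
      intro y hy
      exact (hXJ y hy).symm
    | cons i l ih =>
      have hg := contDiffOn_iterDir (b := b) hΩ hJ l
      have hX' : ContDiffOn ℝ ∞ (fun y => fderiv ℝ X y (b i)) Ω :=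
        (hX.fderiv_of_isOpen hΩ (m := ∞) (by simp)).clm_apply contDiffOn_const
      have hcoord : ∀ m, ContDiffOn ℝ ∞ (fun y => -(b.coord m (fderiv ℝ X y (b i)))) Ω := fun m =>
        ((LinearMap.toContinuousLinearMap (b.coord m)).contDiff.comp_contDiffOn hX').neg
      -- The commutator term in `X(∂_i g) = ∂_i(X g) - dg(∂_i X)`: it involves only first
      -- derivatives of `g`, so it stays within order `l.length + 1`.
      have h2 : JetIdeal b Ω J (l.length + 1) (fun y => ∑ m,
          -(b.coord m (fderiv ℝ X y (b i))) * iterDir b J (m :: l) y) :=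
        sum _ _ fun m _ => mul _ _ (hcoord m) (gen (m :: l) (by simp))
      refine congr _ _ (add _ _ (ih.fderiv_basis hΩ hJ i) h2) ?_
      intro y hy
      have hgy := hg.contDiffAt (hΩ.mem_nhds hy)
      have hd : DifferentiableAt ℝ (fderiv ℝ (iterDir b J l)) y :=
        (hgy.fderiv_right (m := ∞) (by simp)).differentiableAt (by simp)
      have hXd := differentiableAt_of_contDiffOn hΩ hX hy
      have e1 : ∑ m, -(b.coord m (fderiv ℝ X y (b i))) * iterDir b J (m :: l) y =
          - fderiv ℝ (iterDir b J l) y (fderiv ℝ X y (b i)) := by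
        conv_rhs => rw [← b.sum_repr (fderiv ℝ X y (b i)), map_sum]
        simp [iterDir]
      have hs : fderiv ℝ (fderiv ℝ (iterDir b J l)) y (X y) (b i) =
          fderiv ℝ (fderiv ℝ (iterDir b J l)) y (b i) (X y) :=
        (hgy.isSymmSndFDerivAt (by simpa using WithTop.coe_le_coe.2 (le_top : (2 : ℕ∞) ≤ ⊤))) (X y)
          (b i)
      beta_reduce
      rw [e1]
      simp only [iterDir]
      rw [fderiv_clm_apply hd hXd, fderiv_clm_apply hd (differentiableAt_const _)]
      simp [hs]
  | mul c' g hc' hg ih =>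
    refine congr _ _ (add _ _ (mul c' _ hc' ih) (mul (fun y => fderiv ℝ c' y (X y)) g
      (contDiffOn_fderiv_apply hΩ hc' hX) hg)) ?_
    intro y hy
    beta_reduce
    rw [fderiv_fun_mul (differentiableAt_of_contDiffOn hΩ hc' hy)
      (differentiableAt_of_contDiffOn hΩ (hg.contDiffOn hΩ hJ) hy)]
    simp [mul_comm]
  | add g g' hg hg' ih ih' =>
    refine congr _ _ (add _ _ ih ih') ?_
    intro y hy
    beta_reduce
    rw [fderiv_fun_add (differentiableAt_of_contDiffOn hΩ (hg.contDiffOn hΩ hJ) hy)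
      (differentiableAt_of_contDiffOn hΩ (hg'.contDiffOn hΩ hJ) hy)]
    simp
  | congr g g' _ h ih =>
    refine congr _ _ ih ?_
    intro y hy
    have : g =ᶠ[𝓝 y] g' := Filter.eventuallyEq_of_mem (hΩ.mem_nhds hy) h
    simp only [this.fderiv_eq]

end JetIdeal

/-- If some iterated derivative of `J` does not vanish at a zero of `J`, then one of minimal order
is a derivative of an iterated derivative `∂_l J` such that all derivatives of order at most
`l.length` vanish. -/
theorem exists_minimal_iterDir {y : E} (hJ0 : J y = 0) (h : ∃ l : List ι, iterDir b J l y ≠ 0) :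
    ∃ l : List ι, (∀ l' : List ι, l'.length ≤ l.length → iterDir b J l' y = 0) ∧
      fderiv ℝ (iterDir b J l) y ≠ 0 := by
  classical
  have hex : ∃ k : ℕ, ∃ l : List ι, l.length = k ∧ iterDir b J l y ≠ 0 := by
    obtain ⟨l, hl⟩ := h
    exact ⟨_, l, rfl, hl⟩
  obtain ⟨l, hl, hne⟩ := Nat.find_spec hex
  cases l with
  | nil => exact absurd hJ0 hne
  | cons i l =>
    refine ⟨l, fun l' hl' => ?_, fun h0 => hne (by simp [iterDir, h0])⟩
    by_contra hc
    have := Nat.find_min' hex ⟨l', rfl, hc⟩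
    simp at hl
    omega

/-- An analytic function all of whose iterated derivatives vanish at a point vanishes near it. -/
theorem eventually_eq_zero_of_iterDir [Finite ι] (hΩ : IsOpen Ω) (hJ : AnalyticOnNhd ℝ J Ω) {y : E}
    (hy : y ∈ Ω) (h : ∀ l : List ι, iterDir b J l y = 0) : J =ᶠ[𝓝 y] 0 := by
  have hb : FiniteDimensional ℝ E := b.finiteDimensional_of_finite
  have hJs : ContDiffOn ℝ ∞ J Ω := (hJ.contDiffOn hΩ.uniqueDiffOn).of_le le_top
  -- Values on basis vectors determine a multilinear map, so all Taylor coefficients at `y` vanish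
  -- once the iterated directional derivatives do.
  have key : ∀ k : ℕ, ∀ z ∈ Ω, ∀ m : Fin k → ι,
      iteratedFDeriv ℝ k J z (fun j => b (m j)) = iterDir b J (List.ofFn m) z := by
    intro k
    induction k with
    | zero => intro z _ m; simp [iterDir]
    | succ k ih =>
      intro z hz m
      rw [iteratedFDeriv_succ_apply_left, List.ofFn_succ]
      have hd : DifferentiableAt ℝ (iteratedFDeriv ℝ k J) z :=
        ((hJs.contDiffAt (hΩ.mem_nhds hz)).iteratedFDeriv_right (m := 1) (i := k)
          (by exact_mod_cast le_top)).differentiableAt one_ne_zero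
      have he : (fun x => iteratedFDeriv ℝ k J x (fun j => b (m j.succ))) =ᶠ[𝓝 z]
          iterDir b J (List.ofFn fun j => m j.succ) :=
        Filter.eventuallyEq_of_mem (hΩ.mem_nhds hz) fun x hx => ih x hx _
      simp only [iterDir]
      rw [← he.fderiv_eq]
      have := (ContinuousMultilinearMap.apply ℝ (fun _ : Fin k => E) ℝ
        (fun j => b (m j.succ))).hasFDerivAt.comp z hd.hasFDerivAt
      have h2 := this.fderiv
      simp only [Function.comp_def, ContinuousMultilinearMap.apply_apply] at h2
      rw [h2]
      rfl
  have hzero : ∀ k : ℕ, iteratedFDeriv ℝ k J y = 0 := by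
    intro k
    have : (iteratedFDeriv ℝ k J y).toMultilinearMap = 0 :=
      Module.Basis.ext_multilinear (fun _ => b) fun m => by
        simpa [h] using key k y hy m
    ext v
    exact congrArg (fun f => f v) this
  obtain ⟨p, r, hp⟩ := hJ y hy
  have hball : ∀ z ∈ Metric.eball y r, J z = 0 := by
    intro z hz
    have hz' : z - y ∈ Metric.eball (0 : E) r := by
      simpa [Metric.mem_eball, edist_eq_enorm_sub] using hz
    have hsum := hp.hasSum hz'
    have hterm : ∀ k : ℕ, p k (fun _ => z - y) = 0 := by
      intro k
      have := hp.factorial_smul (z - y) k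
      rw [hzero] at this
      simpa [Nat.factorial_ne_zero] using this
    simp only [hterm, add_sub_cancel] at hsum
    exact hsum.unique hasSum_zero
  exact Filter.eventuallyEq_of_mem (Metric.eball_mem_nhds y hp.r_pos) hball

end Jets

/-! ### Sard's lemma on a hypersurface, in equal dimensions. -/

section Sard

open MeasureTheory

variable {E G : Type*} [NormedAddCommGroup E] [NormedSpace ℝ E] [FiniteDimensional ℝ E]
  [NormedAddCommGroup G] [NormedSpace ℝ G] [FiniteDimensional ℝ G] [MeasurableSpace G]
  [BorelSpace G] (μ : Measure G) [μ.IsAddHaarMeasure]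

/-- Sard's lemma on a hypersurface `g = 0` of codimension one for maps to a space of the dimension
of the hypersurface. -/
theorem measure_image_critical_hypersurface (hdim : Module.finrank ℝ E = Module.finrank ℝ G + 1)
    {Ω : Set E} (hΩ : IsOpen Ω) {g : E → ℝ} {ψ : E → G} (hg : ContDiffOn ℝ ∞ g Ω)
    (hψ : ContDiffOn ℝ ∞ ψ Ω) :
    μ (ψ '' {y ∈ Ω | g y = 0 ∧ fderiv ℝ g y ≠ 0 ∧
      ∃ x, x ≠ 0 ∧ fderiv ℝ g y x = 0 ∧ fderiv ℝ ψ y x = 0}) = 0 := by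
  set S := {y ∈ Ω | g y = 0 ∧ fderiv ℝ g y ≠ 0 ∧
    ∃ x, x ≠ 0 ∧ fderiv ℝ g y x = 0 ∧ fderiv ℝ ψ y x = 0} with hS
  -- A local statement suffices: countably many of these neighbourhoods cover `S`.
  have hloc : ∀ y₀ ∈ S, ∃ U ∈ 𝓝[S] y₀, μ (ψ '' (S ∩ U)) = 0 := by
    intro y₀ hy₀
    obtain ⟨hyΩ, hgy, hβ, -⟩ := hy₀
    set β := fderiv ℝ g y₀
    have hker : Module.finrank ℝ (LinearMap.ker (β : E →ₗ[ℝ] ℝ)) = Module.finrank ℝ G := by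
      have h1 := LinearMap.finrank_range_add_finrank_ker (β : E →ₗ[ℝ] ℝ)
      have h2 : LinearMap.range (β : E →ₗ[ℝ] ℝ) = ⊤ :=
        LinearMap.range_eq_top.2 (LinearMap.surjective (fun h => hβ (by
          ext x; exact LinearMap.congr_fun h x)))
      rw [h2, finrank_top, Module.finrank_self, hdim] at h1
      omega
    obtain ⟨v₀, hv₀⟩ : ∃ v, β v = 1 := by
      obtain ⟨v, hv⟩ : ∃ v, β v ≠ 0 := by
        by_contra! h
        exact hβ (ContinuousLinearMap.ext h)
      exact ⟨(β v)⁻¹ • v, by simp [hv]⟩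
    set κ := LinearEquiv.ofFinrankEq _ G hker
    set A : E →L[ℝ] G := LinearMap.toContinuousLinearMap
      (κ.toLinearMap ∘ₗ (LinearMap.codRestrict (LinearMap.ker (β : E →ₗ[ℝ] ℝ))
        (LinearMap.id - (β : E →ₗ[ℝ] ℝ).smulRight v₀) (fun x => by simp [hv₀])))
    have hA : ∀ x, β x = 0 → A x = 0 → x = 0 := by
      intro x hx hAx
      have h1 : κ ⟨x, hx⟩ = A x := by
        refine congrArg κ (Subtype.ext ?_)
        change x = x - β x • v₀
        simp [hx]
      exact congrArg Subtype.val (κ.map_eq_zero_iff.1 (h1.trans hAx))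
    set Λ : E →L[ℝ] G × ℝ := A.prod β
    have hΛinj : Function.Injective Λ := by
      rw [injective_iff_map_eq_zero]
      intro x hx
      have h1 := Prod.ext_iff.1 hx
      exact hA x h1.2 h1.1
    set Λe : E ≃L[ℝ] G × ℝ := (LinearEquiv.ofInjectiveOfFinrankEq (Λ : E →ₗ[ℝ] G × ℝ) hΛinj
      (by simp [hdim])).toContinuousLinearEquiv
    have hΛe : (Λe : E →L[ℝ] G × ℝ) = Λ := by ext x <;> rfl
    -- `A` is the projection along `v₀` onto `ker β`, identified with `G`. Hence `Θ` is a local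
    -- diffeomorphism straightening `g = 0` to `G × {0}`.
    set Θ : E → G × ℝ := fun y => (A y, g y)
    have hΘs : ContDiffOn ℝ ∞ Θ Ω := (A.contDiff.contDiffOn).prodMk hg
    have hΘ' : ∀ y ∈ Ω, HasFDerivAt Θ (A.prod (fderiv ℝ g y)) y := fun y hy =>
      A.hasFDerivAt.prodMk (differentiableAt_of_contDiffOn hΩ hg hy).hasFDerivAt
    have hΘc : ContDiffAt ℝ 1 Θ y₀ := (hΘs.contDiffAt (hΩ.mem_nhds hyΩ)).of_le (by simp)
    have hΘd : HasFDerivAt Θ (Λe : E →L[ℝ] G × ℝ) y₀ := by rw [hΛe]; exact hΘ' y₀ hyΩ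
    set e := hΘc.toOpenPartialHomeomorph Θ hΘd one_ne_zero
    have he : ∀ y, e y = Θ y := fun y => rfl
    have hy₀e : y₀ ∈ e.source := hΘc.mem_toOpenPartialHomeomorph_source hΘd one_ne_zero
    have hinv : ContDiffAt ℝ 1 e.symm (Θ y₀) := hΘc.to_localInverse hΘd one_ne_zero
    have hev : ∀ᶠ z in 𝓝 (Θ y₀), DifferentiableAt ℝ e.symm z := by
      filter_upwards [hinv.eventually (by simp)] with z hz
      exact hz.differentiableAt one_ne_zero
    have hev' : ∀ᶠ y in 𝓝 y₀, DifferentiableAt ℝ e.symm (Θ y) :=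
      hΘc.continuousAt.eventually hev
    refine ⟨{y | DifferentiableAt ℝ e.symm (Θ y) ∧ y ∈ e.source}, mem_nhdsWithin_of_mem_nhds
      (hev'.and (e.open_source.mem_nhds hy₀e)), ?_⟩
    set U := {y | DifferentiableAt ℝ e.symm (Θ y) ∧ y ∈ e.source}
    -- The restriction of `ψ` to the hypersurface, in the straightened coordinate.
    set h : G → G := fun z => ψ (e.symm (z, 0))
    have hsub : ψ '' (S ∩ U) ⊆ h '' (A '' (S ∩ U)) := by
      rintro _ ⟨y, hy, rfl⟩
      refine ⟨A y, ⟨y, hy, rfl⟩, ?_⟩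
      have : (A y, (0 : ℝ)) = e y := by rw [he]; simp [Θ, hy.1.2.1]
      simp only [h]
      rw [this, e.left_inv hy.2.2]
    refine measure_mono_null hsub ?_
    have hderiv : ∀ y ∈ S ∩ U, HasFDerivAt h (((fderiv ℝ ψ y).comp (fderiv ℝ e.symm (Θ y))).comp
        (ContinuousLinearMap.inl ℝ G ℝ)) (A y) := by
      intro y hy
      have h0 : (A y, (0 : ℝ)) = Θ y := by simp [Θ, hy.1.2.1]
      have h1 : HasFDerivAt (fun z : G => (z, (0 : ℝ))) (ContinuousLinearMap.inl ℝ G ℝ) (A y) :=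
        (ContinuousLinearMap.inl ℝ G ℝ).hasFDerivAt
      have h2 : HasFDerivAt e.symm (fderiv ℝ e.symm (Θ y)) (A y, (0 : ℝ)) := by
        rw [h0]; exact hy.2.1.hasFDerivAt
      have h3 : HasFDerivAt ψ (fderiv ℝ ψ y) (e.symm (A y, (0 : ℝ))) := by
        rw [h0, ← he, e.left_inv hy.2.2]
        exact (differentiableAt_of_contDiffOn hΩ hψ hy.1.1).hasFDerivAt
      exact (h3.comp _ h2).comp (A y) h1
    set h' : G → G →L[ℝ] G := fun z => fderiv ℝ h z
    refine addHaar_image_eq_zero_of_det_fderivWithin_eq_zero μ (f' := h') ?_ ?_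
    · rintro _ ⟨y, hy, rfl⟩
      exact (hderiv y hy).differentiableAt.hasFDerivAt.hasFDerivWithinAt
    · rintro _ ⟨y, hy, rfl⟩
      simp only [h', (hderiv y hy).fderiv]
      obtain ⟨x, hx0, hgx, hψx⟩ := hy.1.2.2.2
      have hid : (fderiv ℝ e.symm (Θ y)).comp (A.prod (fderiv ℝ g y)) =
          ContinuousLinearMap.id ℝ E := by
        have h1 : HasFDerivAt (fun z => e.symm (Θ z))
            ((fderiv ℝ e.symm (Θ y)).comp (A.prod (fderiv ℝ g y))) y :=
          hy.2.1.hasFDerivAt.comp y (hΘ' y hy.1.1)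
        have h2 : (fun z => e.symm (Θ z)) =ᶠ[𝓝 y] id :=
          Filter.eventuallyEq_of_mem (e.open_source.mem_nhds hy.2.2) fun z hz => e.left_inv hz
        exact (h1.congr_of_eventuallyEq h2.symm).unique (hasFDerivAt_id y)
      -- The critical direction `x` is tangent to the hypersurface and corresponds to `A x ≠ 0`,
      -- which the derivative of `h` kills; so its determinant is 0.
      have hQ : fderiv ℝ e.symm (Θ y) (A x, 0) = x := by
        have := congrArg (fun T : E →L[ℝ] E => T x) hid
        simpa [hgx] using this
      have hAx : A x ≠ 0 := by
        intro h0
        rw [h0, ← Prod.zero_eq_mk, map_zero] at hQ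
        exact hx0 hQ.symm
      by_contra hdet
      have hinj := (LinearMap.equivOfDetNeZero _ hdet).injective
      refine hAx (hinj ?_)
      rw [map_zero]
      change fderiv ℝ ψ y (fderiv ℝ e.symm (Θ y) (A x, 0)) = 0
      rw [hQ, hψx]
  choose! U hU hU0 using hloc
  obtain ⟨t, htS, htc, ht⟩ := TopologicalSpace.countable_cover_nhdsWithin hU
  refine measure_mono_null (t := ⋃ y ∈ t, ψ '' (S ∩ U y)) ?_
    ((measure_biUnion_null_iff htc).2 fun y hy => hU0 y (htS hy))
  rintro _ ⟨y, hy, rfl⟩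
  obtain ⟨i, hi, hyi⟩ := Set.mem_iUnion₂.1 (ht hy)
  exact Set.mem_iUnion₂.2 ⟨i, hi, y, ⟨hy, hyi⟩, rfl⟩

end Sard

/-! ### Related vector fields and the critical values of a Jacobi morphism. -/

section Related

open MeasureTheory

/-- The vector `w(α, ·)` in the standard coordinates. -/
def sharp {d : ℕ} (w : ⋀[ℝ]^2 (Model d)) (α : Module.Dual ℝ (Model d)) : Model d :=
  ∑ m, bivectorEval w α ((stdBasis d).coord m) • stdBasis d m

theorem apply_sharp {d : ℕ} (w : ⋀[ℝ]^2 (Model d)) (α γ : Module.Dual ℝ (Model d)) :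
    γ (sharp w α) = bivectorEval w α γ := by
  have h : γ = ∑ m, γ (stdBasis d m) • (stdBasis d).coord m := by
    refine (stdBasis d).ext fun i => ?_
    simp
  rw [sharp, map_sum]
  conv_rhs => rw [h, ← bivectorForm_apply, map_sum]
  simp only [map_smul, smul_eq_mul, bivectorForm_apply, mul_comm]

/-- With `T = DF`, this makes the field `w(F^*α, ·)` related by `F` to the field of `α` for the
pushed-forward bivector. -/
theorem map_sharp {d : ℕ} (w : ⋀[ℝ]^2 (Model d)) (T : Model d →ₗ[ℝ] Model d)
    (α : Module.Dual ℝ (Model d)) :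
    T (sharp w (α ∘ₗ T)) = sharp (exteriorPower.map 2 T w) α := by
  refine (stdBasis d).ext_elem fun i => ?_
  have h1 := apply_sharp w (α ∘ₗ T) ((stdBasis d).coord i ∘ₗ T)
  have h2 := apply_sharp (exteriorPower.map 2 T w) α ((stdBasis d).coord i)
  rw [bivectorEval_map] at h2
  exact h1.trans h2.symm

theorem contDiffOn_sharp {d : ℕ} {r : WithTop ℕ∞} {Ω : Set (Model d)}
    {w : Model d → ⋀[ℝ]^2 (Model d)} {α : Model d → Module.Dual ℝ (Model d)}
    (hw : ∀ i j, ContDiffOn ℝ r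
      (fun y => bivectorEval (w y) ((stdBasis d).coord i) ((stdBasis d).coord j)) Ω)
    (hα : ∀ i, ContDiffOn ℝ r (fun y => α y (stdBasis d i)) Ω) :
    ContDiffOn ℝ r (fun y => sharp (w y) (α y)) Ω := by
  refine ContDiffOn.sum fun m _ => ContDiffOn.fun_smul ?_ contDiffOn_const
  have h : (fun y => bivectorEval (w y) (α y) ((stdBasis d).coord m)) = fun y => ∑ i,
      α y (stdBasis d i) * bivectorEval (w y) ((stdBasis d).coord i) ((stdBasis d).coord m) := by
    funext y
    have h : α y = ∑ i, α y (stdBasis d i) • (stdBasis d).coord i := by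
      refine (stdBasis d).ext fun i => ?_
      simp
    conv_lhs => rw [h, ← bivectorForm_apply, map_sum]
    simp
  rw [h]
  exact ContDiffOn.sum fun i _ => (hα i).mul (hw i m)

theorem bivectorEval_comp_eq_zero {d : ℕ} {w : ⋀[ℝ]^2 (Model d)} {T : Model d →ₗ[ℝ] Model d}
    {β : Module.Dual ℝ (Model d)}
    (h : ∀ a, bivectorEval w ((stdBasis d).coord a ∘ₗ T) β = 0) (α : Module.Dual ℝ (Model d)) :
    bivectorEval w (α ∘ₗ T) β = 0 := by
  have hα : α ∘ₗ T = ∑ m, α (stdBasis d m) • ((stdBasis d).coord m ∘ₗ T) := by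
    ext x
    conv_lhs => rw [LinearMap.comp_apply, ← (stdBasis d).sum_repr (T x), map_sum]
    simp [mul_comm]
  rw [hα, ← bivectorForm_apply, map_sum, LinearMap.sum_apply]
  refine Finset.sum_eq_zero fun m _ => ?_
  rw [map_smul, LinearMap.smul_apply, bivectorForm_apply, h, smul_zero]

theorem contDiff_trace {E : Type*} [NormedAddCommGroup E] [NormedSpace ℝ E]
    [FiniteDimensional ℝ E] {r : WithTop ℕ∞} :
    ContDiff ℝ r (fun T : E →L[ℝ] E => LinearMap.trace ℝ E (T : E →ₗ[ℝ] E)) := by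
  set b := Module.finBasis ℝ E
  have h : (fun T : E →L[ℝ] E => LinearMap.trace ℝ E (T : E →ₗ[ℝ] E)) =
      fun T : E →L[ℝ] E => ∑ i, LinearMap.toContinuousLinearMap (b.coord i) (T (b i)) := by
    funext T
    simp [LinearMap.trace_eq_matrix_trace ℝ b, Matrix.trace, LinearMap.toMatrix_apply]
  rw [h]
  exact ContDiff.sum fun i _ =>
    (ContinuousLinearMap.contDiff _).comp (contDiff_id.clm_apply contDiff_const)

/-- A vector field that is `F`-related to a smooth vector field preserves the jet ideals of the
Jacobian determinant of `F`. -/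
theorem JetIdeal.fderiv_field_of_related {E ι : Type*} [NormedAddCommGroup E] [NormedSpace ℝ E]
    [FiniteDimensional ℝ E] [Fintype ι] {b : Module.Basis ι ℝ E} {Ω Ω' : Set E} (hΩ : IsOpen Ω)
    (hΩ' : IsOpen Ω') {F X Z : E → E} (hF : ContDiffOn ℝ ∞ F Ω) (hFΩ : Set.MapsTo F Ω Ω')
    (hX : ContDiffOn ℝ ∞ X Ω) (hZ : ContDiffOn ℝ ∞ Z Ω')
    (hXZ : ∀ y ∈ Ω, fderiv ℝ F y (X y) = Z (F y)) {k : ℕ} {g : E → ℝ}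
    (hg : JetIdeal b Ω (fun y => (fderiv ℝ F y).det) k g) :
    JetIdeal b Ω (fun y => (fderiv ℝ F y).det) k (fun y => fderiv ℝ g y (X y)) := by
  have hdF : ContDiffOn ℝ ∞ (fderiv ℝ F) Ω := hF.fderiv_of_isOpen hΩ (by simp)
  refine hg.fderiv_field hΩ (contDiff_det.comp_contDiffOn hdF) hX (c := fun y =>
    LinearMap.trace ℝ E (fderiv ℝ Z (F y) : E →ₗ[ℝ] E) -
      LinearMap.trace ℝ E (fderiv ℝ X y : E →ₗ[ℝ] E)) ?_ ?_
  · refine ContDiffOn.sub ?_ ?_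
    · exact contDiff_trace.comp_contDiffOn ((hZ.fderiv_of_isOpen hΩ' (by simp)).comp hF hFΩ)
    · exact contDiff_trace.comp_contDiffOn (hX.fderiv_of_isOpen hΩ (by simp))
  · intro y hy
    exact fderiv_jacobian_of_related
      ((hF.contDiffAt (hΩ.mem_nhds hy)).of_le (WithTop.coe_le_coe.2 le_top))
      (differentiableAt_of_contDiffOn hΩ hX hy)
      (differentiableAt_of_contDiffOn hΩ' hZ (hFΩ hy))
      (Filter.eventually_of_mem (hΩ.mem_nhds hy) hXZ)

theorem analyticOnNhd_jacobian {E : Type*} [NormedAddCommGroup E] [NormedSpace ℝ E]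
    [FiniteDimensional ℝ E] {Ω : Set E} (hΩ : IsOpen Ω) {F : E → E} (hF : ContDiffOn ℝ ω F Ω) :
    AnalyticOnNhd ℝ (fun y => (fderiv ℝ F y).det) Ω := by
  have h : ContDiffOn ℝ ω (fun y => (fderiv ℝ F y).det) Ω :=
    contDiff_det.comp_contDiffOn (hF.fderiv_of_isOpen hΩ (by simp))
  exact (hΩ.analyticOn_iff_analyticOnNhd).1 h.analyticOn

/-- Let the analytic map `F` relate a nondegenerate pair `(w, ε)` to a pair `(W, Y)`, and let the
Jacobian of `F` vanish identically near no point. The critical points of `F` are mapped to a null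
set by `pr ∘ F`, for every linear projection `pr` to a space of dimension one less. -/
theorem measure_image_critical_eq_zero {n : ℕ} {G : Type*} [NormedAddCommGroup G]
    [NormedSpace ℝ G] [FiniteDimensional ℝ G] [MeasurableSpace G] [BorelSpace G] (μ : Measure G)
    [μ.IsAddHaarMeasure] (hG : Module.finrank ℝ G = 2 * n)
    (pr : Model (2 * n + 1) →L[ℝ] G) {Ω Ω' : Set (Model (2 * n + 1))} (hΩ : IsOpen Ω)
    (hΩ' : IsOpen Ω') {F : Model (2 * n + 1) → Model (2 * n + 1)} (hF : ContDiffOn ℝ ω F Ω)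
    (hFΩ : Set.MapsTo F Ω Ω')
    {w W : Model (2 * n + 1) → ⋀[ℝ]^2 (Model (2 * n + 1))}
    {ε Y : Model (2 * n + 1) → Model (2 * n + 1)}
    (hw : ∀ i j, ContDiffOn ℝ ∞
      (fun y => bivectorEval (w y) ((stdBasis _).coord i) ((stdBasis _).coord j)) Ω)
    (hε : ContDiffOn ℝ ∞ ε Ω)
    (hW : ∀ i j, ContDiffOn ℝ ∞
      (fun y => bivectorEval (W y) ((stdBasis _).coord i) ((stdBasis _).coord j)) Ω')
    (hY : ContDiffOn ℝ ∞ Y Ω')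
    (hne : ∀ y ∈ Ω, topCoord (w y) (ε y) ≠ 0)
    (hmapw : ∀ y ∈ Ω, exteriorPower.map 2 (fderiv ℝ F y).toLinearMap (w y) = W (F y))
    (hmapε : ∀ y ∈ Ω, fderiv ℝ F y (ε y) = Y (F y))
    (hJne : ∀ y ∈ Ω, ¬ (fun y => (fderiv ℝ F y).det) =ᶠ[𝓝 y] 0) :
    μ ((fun y => pr (F y)) '' {y ∈ Ω | (fderiv ℝ F y).det = 0}) = 0 := by
  set J : Model (2 * n + 1) → ℝ := fun y => (fderiv ℝ F y).det with hJdef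
  have hJa : AnalyticOnNhd ℝ J Ω := analyticOnNhd_jacobian hΩ hF
  have hJ : ContDiffOn ℝ ∞ J Ω := (hJa.contDiffOn hΩ.uniqueDiffOn).of_le le_top
  have hF' : ContDiffOn ℝ ∞ F Ω := hF.of_le le_top
  have hdF : ContDiffOn ℝ ∞ (fderiv ℝ F) Ω := hF'.fderiv_of_isOpen hΩ (by simp)
  set b := stdBasis (2 * n + 1)
  have hrel : ∀ X Z : Model (2 * n + 1) → Model (2 * n + 1), ContDiffOn ℝ ∞ X Ω →
      ContDiffOn ℝ ∞ Z Ω' → (∀ y ∈ Ω, fderiv ℝ F y (X y) = Z (F y)) →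
      ∀ k g, JetIdeal b Ω J k g → JetIdeal b Ω J k (fun y => fderiv ℝ g y (X y)) :=
    fun X Z hX hZ hXZ k g hg => hg.fderiv_field_of_related hΩ hΩ' hF' hFΩ hX hZ hXZ
  have hrelε := hrel ε Y hε hY hmapε
  have hrelX : ∀ a k g, JetIdeal b Ω J k g → JetIdeal b Ω J k (fun y =>
      fderiv ℝ g y (sharp (w y) (b.coord a ∘ₗ (fderiv ℝ F y).toLinearMap))) := by
    intro a
    refine hrel _ (fun x => sharp (W x) (b.coord a)) ?_ ?_ ?_
    · refine contDiffOn_sharp hw fun i => ?_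
      exact (LinearMap.toContinuousLinearMap (b.coord a)).contDiff.comp_contDiffOn
        (hdF.clm_apply contDiffOn_const)
    · exact contDiffOn_sharp hW fun i => contDiffOn_const
    · intro y hy
      rw [← hmapw y hy]
      exact map_sharp (w y) (fderiv ℝ F y).toLinearMap (b.coord a)
  have hψ : ContDiffOn ℝ ∞ (fun y => pr (F y)) Ω := pr.contDiff.comp_contDiffOn hF'
  set S : List (Fin (2 * n + 1)) → Set (Model (2 * n + 1)) := fun l =>
    {y ∈ Ω | iterDir b J l y = 0 ∧ fderiv ℝ (iterDir b J l) y ≠ 0 ∧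
      ∃ x, x ≠ 0 ∧ fderiv ℝ (iterDir b J l) y x = 0 ∧ fderiv ℝ (fun y => pr (F y)) y x = 0} with hS
  have hcov : {y ∈ Ω | (fderiv ℝ F y).det = 0} ⊆ ⋃ l, S l := by
    rintro y ⟨hy, hJy⟩
    have hex : ∃ l, iterDir b J l y ≠ 0 := by
      by_contra! h
      exact hJne y hy (eventually_eq_zero_of_iterDir hΩ hJa hy h)
    obtain ⟨l, hl, hne'⟩ := exists_minimal_iterDir (b := b) hJy hex
    -- With `β` the differential of the chosen derivative of `J`, related fields send it into an
    -- ideal vanishing at `y`, so `β` annihilates them. If the projected map had no critical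
    -- direction in `ker β`, `DF` would be injective there, against the nondegeneracy of `(w, ε)`.
    refine Set.mem_iUnion.2 ⟨l, hy, hl l le_rfl, hne', ?_⟩
    set β := fderiv ℝ (iterDir b J l) y
    have hβε : β (ε y) = 0 :=
      (hrelε _ _ (JetIdeal.gen l le_rfl)).eq_zero hy hl
    have hβX : ∀ a, bivectorEval (w y) (b.coord a ∘ₗ (fderiv ℝ F y).toLinearMap) β.toLinearMap
        = 0 := by
      intro a
      rw [← apply_sharp]
      exact (hrelX a _ _ (JetIdeal.gen l le_rfl)).eq_zero hy hl
    have hβα := bivectorEval_comp_eq_zero hβX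
    by_contra hcon
    push Not at hcon
    refine hne y hy (topCoord_eq_zero_of_injOn (w y) (ε y) β.toLinearMap ?_ hβε
      (fderiv ℝ F y).toLinearMap ?_ hβα)
    · intro h0
      exact hne' (ContinuousLinearMap.ext fun x => LinearMap.congr_fun h0 x)
    · intro x hx hFx
      by_contra hx0
      refine hcon x hx0 hx ?_
      have hd := differentiableAt_of_contDiffOn hΩ hF' hy
      have : fderiv ℝ (fun y => pr (F y)) y = pr.comp (fderiv ℝ F y) :=
        (pr.hasFDerivAt.comp y hd.hasFDerivAt).fderiv
      rw [this, ContinuousLinearMap.comp_apply]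
      exact (congrArg pr hFx).trans (map_zero pr)
  refine measure_mono_null (Set.image_mono hcov) ?_
  rw [Set.image_iUnion, measure_iUnion_null_iff]
  intro l
  exact measure_image_critical_hypersurface μ (by simp [hG]) hΩ (contDiffOn_iterDir hΩ hJ l) hψ

end Related

/-! ### Homogeneous and odd functions on a ball. -/

section Homogeneous

variable {E : Type*} [NormedAddCommGroup E] [NormedSpace ℝ E]

/-- Euler's theorem: a solution of `df(x) x = k f(x)` on a ball is homogeneous of degree `k`. -/
theorem homogeneous_of_euler {f : E → ℝ} {r : ℝ} {k : ℕ}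
    (hf : DifferentiableOn ℝ f (Metric.ball 0 r))
    (hE : ∀ x ∈ Metric.ball (0 : E) r, fderiv ℝ f x x = k * f x) {x : E}
    (hx : x ∈ Metric.ball (0 : E) r) {t : ℝ} (ht : 0 < t) (htx : t • x ∈ Metric.ball (0 : E) r) :
    f (t • x) = t ^ k * f x := by
  set s : Set ℝ := Set.Ioi 0 ∩ (fun t : ℝ => t • x) ⁻¹' Metric.ball 0 r
  have hsconv : Convex ℝ s :=
    (convex_Ioi 0).inter ((convex_ball (0 : E) r).linear_preimage
      (LinearMap.toSpanSingleton ℝ E x))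
  have hsopen : IsOpen s :=
    isOpen_Ioi.inter (Metric.isOpen_ball.preimage (continuous_id.smul continuous_const))
  -- Euler's equation says exactly that `f(ux) / u^k` is constant along the ray; the admissible `u`
  -- form an interval by convexity of the ball.
  have hder : ∀ u ∈ s, HasDerivAt (fun u : ℝ => f (u • x) * (u ^ k)⁻¹) 0 u := by
    intro u hu
    have hu0 : u ≠ 0 := ne_of_gt hu.1
    have h1 : HasDerivAt (fun u : ℝ => u • x) x u := by
      simpa using (hasDerivAt_id u).smul_const x
    have h2 : HasDerivAt (fun u : ℝ => f (u • x)) (fderiv ℝ f (u • x) x) u :=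
      ((hf _ hu.2).differentiableAt (Metric.isOpen_ball.mem_nhds hu.2)).hasFDerivAt.comp_hasDerivAt
        u h1
    have h3 := h2.mul ((hasDerivAt_pow k u).inv (pow_ne_zero k hu0))
    refine h3.congr_deriv ?_
    have h4 := hE _ hu.2
    rw [map_smul, smul_eq_mul] at h4
    have h5 : fderiv ℝ f (u • x) x = k * f (u • x) / u := by
      rw [eq_div_iff hu0, mul_comm, h4]
    rw [h5]
    cases k with
    | zero => simp
    | succ k =>
      simp only [Nat.add_sub_cancel, Pi.inv_apply]
      field_simp
      ring
  have hconst := hsopen.is_const_of_deriv_eq_zero hsconv.isPreconnected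
    (fun u hu => (hder u hu).differentiableAt.differentiableWithinAt)
    (fun u hu => (hder u hu).deriv) (x := t) (y := 1) ⟨ht, htx⟩ ⟨Set.mem_Ioi.2 one_pos, by simpa using hx⟩
  simp only [one_smul, one_pow, inv_one, mul_one] at hconst
  rw [← hconst]
  field_simp

/-- Along the line through `x`, the analytic functions `f(tx)` and `t² f(x)` agree near `t = 1`,
hence also at `t = -1`. This is where analyticity gives more than positive homogeneity. -/
theorem even_of_homogeneous {f : E → ℝ} {r : ℝ} (hf : AnalyticOnNhd ℝ f (Metric.ball 0 r))
    (hh : ∀ x ∈ Metric.ball (0 : E) r, ∀ t : ℝ, 0 < t → t • x ∈ Metric.ball (0 : E) r →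
      f (t • x) = t ^ 2 * f x) {x : E} (hx : x ∈ Metric.ball (0 : E) r) : f (-x) = f x := by
  set s : Set ℝ := (fun t : ℝ => t • x) ⁻¹' Metric.ball 0 r
  have hsconv : Convex ℝ s :=
    (convex_ball (0 : E) r).linear_preimage (LinearMap.toSpanSingleton ℝ E x)
  have hsopen : IsOpen s :=
    Metric.isOpen_ball.preimage (continuous_id.smul continuous_const)
  have h1 : (1 : ℝ) ∈ s := by simpa [s] using hx
  have hneg : (-1 : ℝ) ∈ s := by simpa [s] using hx
  have ha : AnalyticOnNhd ℝ (fun t : ℝ => f (t • x)) s := by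
    intro t ht
    exact (hf _ ht).comp (f := fun t : ℝ => t • x)
      ((ContinuousLinearMap.toSpanSingleton ℝ x).analyticAt t)
  have hb : AnalyticOnNhd ℝ (fun t : ℝ => t ^ 2 * f x) s := fun t _ =>
    (analyticAt_id.pow 2).mul analyticAt_const
  have hev : (fun t : ℝ => f (t • x)) =ᶠ[𝓝 1] fun t => t ^ 2 * f x := by
    filter_upwards [hsopen.mem_nhds h1, lt_mem_nhds one_pos] with t hts ht
    exact hh x hx t ht hts
  have := ha.eqOn_of_preconnected_of_eventuallyEq hb hsconv.isPreconnected h1 hev hneg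
  simpa using this

/-- Bound `f` on a compact sphere inside the open ball and rescale; at the origin, homogeneity of
nonzero degree forces the value 0. -/
theorem exists_bound_of_homogeneous [FiniteDimensional ℝ E] {f : E → ℝ} {r : ℝ} (hr : 0 < r)
    {k : ℕ} (hk : k ≠ 0) (hf : ContinuousOn f (Metric.ball 0 r))
    (hh : ∀ x ∈ Metric.ball (0 : E) r, ∀ t : ℝ, 0 < t → t • x ∈ Metric.ball (0 : E) r →
      f (t • x) = t ^ k * f x) :
    ∃ C : ℝ, 0 ≤ C ∧ ∀ x ∈ Metric.ball (0 : E) r, |f x| ≤ C * ‖x‖ ^ k := by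
  have hsub : Metric.sphere (0 : E) (r / 2) ⊆ Metric.ball 0 r := fun x hx => by
    rw [mem_sphere_zero_iff_norm] at hx
    rw [mem_ball_zero_iff, hx]
    linarith
  obtain ⟨C, hC⟩ := (isCompact_sphere (0 : E) (r / 2)).exists_bound_of_continuousOn
    (hf.mono hsub)
  refine ⟨|C| / (r / 2) ^ k, by positivity, fun x hx => ?_⟩
  rcases eq_or_ne x 0 with rfl | hx0
  · have h := hh 0 hx (1 / 2) (by norm_num) (by simpa using hr)
    rw [smul_zero] at h
    have h2 : ((1 : ℝ) / 2) ^ k < 1 := pow_lt_one₀ (by norm_num) (by norm_num) hk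
    have h3 : f 0 = 0 := by
      have : (1 - ((1 : ℝ) / 2) ^ k) * f 0 = 0 := by linarith
      rcases mul_eq_zero.1 this with h4 | h4
      · linarith
      · exact h4
    simp [h3, hk]
  · have hxn : 0 < ‖x‖ := norm_pos_iff.2 hx0
    set z := (r / 2 / ‖x‖) • x
    have hz : z ∈ Metric.sphere (0 : E) (r / 2) := by
      rw [mem_sphere_zero_iff_norm, norm_smul, Real.norm_eq_abs, abs_of_pos (by positivity)]
      field_simp
    have hxz : x = (‖x‖ / (r / 2)) • z := by
      rw [smul_smul]
      have : ‖x‖ / (r / 2) * (r / 2 / ‖x‖) = 1 := by field_simp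
      rw [this, one_smul]
    have h := hh z (hsub hz) (‖x‖ / (r / 2)) (by positivity) (by rwa [← hxz])
    rw [← hxz] at h
    rw [h, abs_mul, abs_of_nonneg (by positivity)]
    have h2 : |f z| ≤ |C| := (hC z hz).trans (le_abs_self C)
    calc (‖x‖ / (r / 2)) ^ k * |f z| ≤ (‖x‖ / (r / 2)) ^ k * |C| := by gcongr
      _ = |C| / (r / 2) ^ k * ‖x‖ ^ k := by rw [div_pow]; ring

/-- The zeros of a continuous odd function that is not identically zero on a ball project onto a
neighbourhood of the origin along some line. -/
theorem exists_projection_zeros {G : Type*} [NormedAddCommGroup G] [NormedSpace ℝ G]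
    [FiniteDimensional ℝ G] [FiniteDimensional ℝ E]
    (hdim : Module.finrank ℝ E = Module.finrank ℝ G + 1) {f : E → ℝ} {r : ℝ}
    (hf : ContinuousOn f (Metric.ball 0 r))
    (hodd : ∀ x ∈ Metric.ball (0 : E) r, f (-x) = - f x)
    (hne : ∃ x ∈ Metric.ball (0 : E) r, f x ≠ 0) :
    ∃ pr : E →L[ℝ] G, ∃ ρ > 0, ∀ c ∈ Metric.ball (0 : G) ρ,
      ∃ x ∈ Metric.ball (0 : E) r, f x = 0 ∧ pr x = c := by
  obtain ⟨v, hv, hfv⟩ : ∃ v ∈ Metric.ball (0 : E) r, 0 < f v := by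
    obtain ⟨x, hx, hfx⟩ := hne
    rcases lt_or_gt_of_ne hfx with h | h
    · exact ⟨-x, by simpa using hx, by rw [hodd x hx]; linarith⟩
    · exact ⟨x, hx, h⟩
  have hv' : -v ∈ Metric.ball (0 : E) r := by simpa using hv
  have hv0 : v ≠ 0 := by
    rintro rfl
    have := hodd 0 hv
    rw [neg_zero] at this
    linarith
  obtain ⟨β, hβ⟩ : ∃ β : E →ₗ[ℝ] ℝ, β v = 1 := by
    obtain ⟨β, hβ⟩ := SeparatingDual.exists_eq_one (R := ℝ) hv0
    exact ⟨β.toLinearMap, hβ⟩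
  have hker : Module.finrank ℝ (LinearMap.ker β) = Module.finrank ℝ G := by
    have h1 := LinearMap.finrank_range_add_finrank_ker β
    have h2 : LinearMap.range β = ⊤ :=
      LinearMap.range_eq_top.2 (LinearMap.surjective (fun h => by simp [h] at hβ))
    rw [h2, finrank_top, Module.finrank_self, hdim] at h1
    omega
  set κ := LinearEquiv.ofFinrankEq _ G hker
  set pr : E →L[ℝ] G := LinearMap.toContinuousLinearMap
    (κ.toLinearMap ∘ₗ (LinearMap.codRestrict (LinearMap.ker β)
      (LinearMap.id - β.smulRight v) (fun x => by simp [hβ])))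
  -- A linear section of `pr`, the projection along `v`; it parametrises the lines parallel to `v`.
  set s : G →L[ℝ] E := LinearMap.toContinuousLinearMap
    ((LinearMap.ker β).subtype ∘ₗ κ.symm.toLinearMap)
  have hprv : pr v = 0 := by
    refine (congrArg κ (Subtype.ext ?_)).trans (map_zero κ)
    change v - β v • v = 0
    simp [hβ]
  have hprs : ∀ c, pr (s c) = c := by
    intro c
    refine (congrArg κ (Subtype.ext ?_)).trans (κ.apply_symm_apply c)
    change (κ.symm c : E) - β (κ.symm c) • v = κ.symm c
    have : β (κ.symm c) = 0 := (κ.symm c).2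
    rw [this, zero_smul, sub_zero]
  have hlim : ∀ v : E, Filter.Tendsto (fun c : G => v + s c) (𝓝 0) (𝓝 v) := fun v => by
    have : Continuous fun c : G => v + s c := continuous_const.add s.continuous
    simpa using this.tendsto 0
  have hev : ∀ᶠ c in 𝓝 (0 : G), (v + s c ∈ Metric.ball (0 : E) r ∧ 0 < f (v + s c)) ∧
      (-v + s c ∈ Metric.ball (0 : E) r ∧ f (-v + s c) < 0) := by
    have hc : ContinuousAt f v := hf.continuousAt (Metric.isOpen_ball.mem_nhds hv)
    have hc' : ContinuousAt f (-v) := hf.continuousAt (Metric.isOpen_ball.mem_nhds hv')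
    refine (((hlim v).eventually (Metric.isOpen_ball.mem_nhds hv)).and
      ((hc.tendsto.comp (hlim v)).eventually_const_lt hfv)).and
      (((hlim (-v)).eventually (Metric.isOpen_ball.mem_nhds hv')).and
      ((hc'.tendsto.comp (hlim (-v))).eventually_lt_const ?_))
    rw [hodd v hv]
    linarith
  obtain ⟨ρ, hρ, hball⟩ := Metric.eventually_nhds_iff_ball.1 hev
  refine ⟨pr, ρ, hρ, fun c hc => ?_⟩
  obtain ⟨⟨h1, h2⟩, h3, h4⟩ := hball c hc
  have hseg : segment ℝ (-v + s c) (v + s c) ⊆ Metric.ball 0 r :=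
    (convex_ball (0 : E) r).segment_subset h3 h1
  -- For small `c`, `f` keeps the opposite signs it has at `v` and `-v`, so it vanishes on the
  -- translated segment, all of which projects to `c`.
  obtain ⟨x, hx, hfx⟩ := (convex_segment (-v + s c) (v + s c)).isPreconnected.intermediate_value
    (left_mem_segment ℝ _ _) (right_mem_segment ℝ _ _) (hf.mono hseg) ⟨h4.le, h2.le⟩
  refine ⟨x, hseg hx, hfx, ?_⟩
  obtain ⟨a, a', ha, ha', haa, rfl⟩ := hx
  simp only [map_add, map_smul, map_neg, hprv, hprs]
  rw [neg_zero, zero_add, ← add_smul, haa, one_smul]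

end Homogeneous

/-! ### Local expressions of tensor fields in charts. -/

section Charts

open IsManifold

variable {d : ℕ} {M : Type*} [TopologicalSpace M] [ChartedSpace (Model d) M]

/-- The differential of a chart, as a linear map to the model space. -/
def chartDeriv (e : OpenPartialHomeomorph M (Model d)) (x : M) :
    TangentSpace (𝓡 d) x →ₗ[ℝ] Model d :=
  (mfderiv (𝓡 d) 𝓘(ℝ, Model d) e x : TangentSpace (𝓡 d) x →L[ℝ] Model d).toLinearMap

/-- The local expression of a bivector field in a chart. -/
def locBiv (e : OpenPartialHomeomorph M (Model d)) (π : BivField d M) (y : Model d) :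
    ⋀[ℝ]^2 (Model d) :=
  exteriorPower.map 2 (chartDeriv e (e.symm y)) (π (e.symm y))

/-- The local expression of a vector field in a chart. -/
def locVec (e : OpenPartialHomeomorph M (Model d)) (E : VField d M) (y : Model d) : Model d :=
  chartDeriv e (e.symm y) (E (e.symm y))

variable {r : WithTop ℕ∞} {e : OpenPartialHomeomorph M (Model d)}

theorem mdifferentiable_of_mem_maximalAtlas (hr : r ≠ 0)
    (he : e ∈ maximalAtlas (𝓡 d) r M) : e.MDifferentiable (𝓡 d) 𝓘(ℝ, Model d) :=
  ⟨(contMDiffOn_of_mem_maximalAtlas he).mdifferentiableOn hr,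
    (contMDiffOn_symm_of_mem_maximalAtlas he).mdifferentiableOn hr⟩

theorem dfAt_comp_chart (hr : r ≠ 0) (he : e ∈ maximalAtlas (𝓡 d) r M) {f : Model d → ℝ} {x : M}
    (hx : x ∈ e.source) (hf : DifferentiableAt ℝ f (e x)) :
    dfAt (d := d) (fun y => f (e y)) x = (fderiv ℝ f (e x)).toLinearMap ∘ₗ chartDeriv e x := by
  have h1 := (mdifferentiable_of_mem_maximalAtlas hr he).mdifferentiableAt hx
  have h2 : mfderiv (𝓡 d) 𝓘(ℝ, ℝ) (f ∘ e) x =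
      (mfderiv 𝓘(ℝ, Model d) 𝓘(ℝ, ℝ) f (e x)).comp (mfderiv (𝓡 d) 𝓘(ℝ, Model d) e x) :=
    mfderiv_comp x hf.mdifferentiableAt h1
  rw [mfderiv_eq_fderiv] at h2
  ext v
  exact congrArg (fun T => T v) h2

theorem dfAt_coord (hr : r ≠ 0) (he : e ∈ maximalAtlas (𝓡 d) r M) {x : M}
    (hx : x ∈ e.source) (i : Fin d) :
    dfAt (d := d) (fun y => e y i) x = (stdBasis d).coord i ∘ₗ chartDeriv e x := by
  have h := dfAt_comp_chart hr he hx (f := fun z : Model d => z i)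
    (EuclideanSpace.proj (𝕜 := ℝ) i).differentiableAt
  have h2 : fderiv ℝ (fun z : Model d => z i) (e x) = EuclideanSpace.proj (𝕜 := ℝ) i :=
    (EuclideanSpace.proj (𝕜 := ℝ) i).hasFDerivAt.fderiv
  rw [h, h2]
  ext v
  simp

theorem dfAt_congr {f g : M → ℝ} {x : M} (h : f =ᶠ[𝓝 x] g) :
    dfAt (d := d) f x = dfAt (d := d) g x := by
  unfold dfAt
  have h2 : mfderiv (𝓡 d) 𝓘(ℝ, ℝ) f x = mfderiv (𝓡 d) 𝓘(ℝ, ℝ) g x := h.mfderiv_eq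
  ext v
  exact congrArg (fun T => T v) h2

theorem bracket_coord (hr : r ≠ 0) (he : e ∈ maximalAtlas (𝓡 d) r M) (π : BivField d M) {y : Model d}
    (hy : y ∈ e.target) (i j : Fin d) :
    π.bracket (fun z => e z i) (fun z => e z j) (e.symm y) =
      bivectorEval (locBiv e π y) ((stdBasis d).coord i) ((stdBasis d).coord j) := by
  rw [locBiv, bivectorEval_map, BivField.bracket, dfAt_coord hr he (e.map_target hy),
    dfAt_coord hr he (e.map_target hy)]

theorem contMDiffOn_coord (he : e ∈ maximalAtlas (𝓡 d) r M) (i : Fin d) :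
    ContMDiffOn (𝓡 d) 𝓘(ℝ, ℝ) r (fun z => e z i) e.source :=
  ((EuclideanSpace.proj (𝕜 := ℝ) i).contMDiff).comp_contMDiffOn (contMDiffOn_of_mem_maximalAtlas he)

theorem contDiffOn_locBiv (hr : r ≠ 0) (he : e ∈ maximalAtlas (𝓡 d) r M) {π : BivField d M}
    (hπ : π.IsSmooth r) (i j : Fin d) :
    ContDiffOn ℝ r
      (fun y => bivectorEval (locBiv e π y) ((stdBasis d).coord i) ((stdBasis d).coord j))
      e.target := by
  have h := hπ e.source e.open_source _ _ (contMDiffOn_coord he i) (contMDiffOn_coord he j)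
  have h2 := h.comp (contMDiffOn_symm_of_mem_maximalAtlas he) (fun y hy => e.map_target hy)
  refine (contMDiffOn_iff_contDiffOn.1 h2).congr fun y hy => ?_
  exact (bracket_coord hr he π hy i j).symm

/-- The tangent bundle trivialisation at `x₀` is given by the differential of the preferred chart.
Such charts suffice on the resolution; in Euler coordinates the field is explicit. -/
theorem contDiffOn_locVec_chartAt [IsManifold (𝓡 d) r M] [IsManifold (𝓡 d) 1 M] {E : VField d M}
    (hE : ContMDiff (𝓡 d) (𝓡 d).tangent r (fun x => (⟨x, E x⟩ : TangentBundle (𝓡 d) M)))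
    [ContMDiffVectorBundle r (Model d) (TangentSpace (𝓡 d) : M → Type _) (𝓡 d)]
    (x₀ : M) : ContDiffOn ℝ r (locVec (chartAt (Model d) x₀) E) (chartAt (Model d) x₀).target := by
  set t := trivializationAt (Model d) (TangentSpace (𝓡 d) : M → Type _) x₀
  have hb : (chartAt (Model d) x₀).source ⊆ t.baseSet := by simp [t]
  have h1 := (t.contMDiffOn_section_iff (IB := 𝓡 d) (n := r) (s := E)
    (chartAt (Model d) x₀).open_source hb).1 hE.contMDiffOn
  have h2 : ContMDiffOn (𝓡 d) 𝓘(ℝ, Model d) r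
      (fun x => chartDeriv (chartAt (Model d) x₀) x (E x)) (chartAt (Model d) x₀).source := by
    refine h1.congr fun x hx => ?_
    have h3 := TangentBundle.continuousLinearMapAt_trivializationAt (I := 𝓡 d) hx
    have h4 := congrArg (fun T => T (E x)) h3
    rw [Bundle.Trivialization.continuousLinearMapAt_apply, Bundle.Trivialization.coe_linearMapAt_of_mem _ (hb hx)] at h4
    exact h4.symm
  have h3 := h2.comp (contMDiffOn_symm_of_mem_maximalAtlas (chart_mem_maximalAtlas (I := 𝓡 d) (n := r) x₀))
    (fun y hy => (chartAt (Model d) x₀).map_target hy)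
  exact contMDiffOn_iff_contDiffOn.1 h3

theorem chartDeriv_ker (hr : r ≠ 0) (he : e ∈ maximalAtlas (𝓡 d) r M) {x : M} (hx : x ∈ e.source) :
    LinearMap.ker (chartDeriv e x) = ⊥ :=
  (mdifferentiable_of_mem_maximalAtlas hr he).ker_mfderiv_eq_bot hx

theorem locBiv_apply (π : BivField d M) {x : M} (hx : x ∈ e.source) :
    locBiv e π (e x) = exteriorPower.map 2 (chartDeriv e x) (π x) := by
  rw [locBiv, e.left_inv hx]

theorem locVec_apply (E : VField d M) {x : M} (hx : x ∈ e.source) :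
    locVec e E (e x) = chartDeriv e x (E x) := by
  rw [locVec, e.left_inv hx]

theorem locVec_euler (hr : r ≠ 0) (he : e ∈ maximalAtlas (𝓡 d) r M) {E : VField d M}
    (hE : ∀ x ∈ e.source, ∀ i : Fin d, E.app (fun y => e y i) x = e x i) {y : Model d}
    (hy : y ∈ e.target) : locVec e E y = y := by
  refine (stdBasis d).ext_elem fun i => ?_
  have h := hE _ (e.map_target hy) i
  rw [VField.app, dfAt_coord hr he (e.map_target hy), e.right_inv hy] at h
  simpa [locVec] using h

/-- The coefficients of `π` in Euler coordinates satisfy Euler's equation for degree two. -/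
theorem fderiv_locBiv_euler [IsManifold (𝓡 d) 1 M] (hr : ∞ ≤ r)
    (he : e ∈ maximalAtlas (𝓡 d) r M)
    {π : BivField d M} {E : VField d M} (hJ : IsJacobi r π E)
    (hE : ∀ x ∈ e.source, ∀ i : Fin d, E.app (fun y => e y i) x = e x i) (i j : Fin d)
    {y : Model d} (hy : y ∈ e.target) :
    fderiv ℝ (fun y => bivectorEval (locBiv e π y) ((stdBasis d).coord i) ((stdBasis d).coord j))
      y y = 2 * bivectorEval (locBiv e π y) ((stdBasis d).coord i) ((stdBasis d).coord j) := by
  have hr0 : r ≠ 0 := (lt_of_lt_of_le (by simp) hr).ne'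
  set P : Model d → ℝ := fun y =>
    bivectorEval (locBiv e π y) ((stdBasis d).coord i) ((stdBasis d).coord j)
  set x := e.symm y
  have hx : x ∈ e.source := e.map_target hy
  have hxy : e x = y := e.right_inv hy
  have hc : ∀ k : Fin d, ContMDiffOn (𝓡 d) 𝓘(ℝ, ℝ) ∞ (fun z => e z k) e.source := fun k =>
    (contMDiffOn_coord he k).of_le hr
  -- Since `E[x_i] = x_i`, each of the two correction terms in `[E, π](dx_i, dx_j)` equals the
  -- coefficient itself, which yields the factor 2.
  have hlie := hJ.lie_biv e.source e.open_source _ _ (hc i) (hc j) x hx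
  have happ : ∀ k : Fin d, E.app (fun z => e z k) =ᶠ[𝓝 x] fun z => e z k := fun k =>
    Filter.eventuallyEq_of_mem (e.open_source.mem_nhds hx) fun z hz => hE z hz k
  have hbr : π.bracket (fun z => e z i) (fun z => e z j) =ᶠ[𝓝 x] fun z => P (e z) := by
    refine Filter.eventuallyEq_of_mem (e.open_source.mem_nhds hx) fun z hz => ?_
    have := bracket_coord hr0 he π (e.map_source hz) i j
    rwa [e.left_inv hz] at this
  have hP : DifferentiableAt ℝ P (e x) := by
    rw [hxy]
    exact ((contDiffOn_locBiv hr0 he hJ.smooth_biv i j).contDiffAt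
      (e.open_target.mem_nhds hy)).differentiableAt hr0
  have h1 : E.app (π.bracket (fun z => e z i) (fun z => e z j)) x = fderiv ℝ P y y := by
    have hv : chartDeriv e x (E x) = y := locVec_euler hr0 he hE hy
    rw [VField.app, dfAt_congr hbr, dfAt_comp_chart hr0 he hx hP, LinearMap.comp_apply, hv, hxy]
    rfl
  have h2 : π.bracket (E.app fun z => e z i) (fun z => e z j) x = P y := by
    refine Eq.trans ?_ (bracket_coord hr0 he π hy i j)
    rw [BivField.bracket, dfAt_congr (happ i)]
    rfl
  have h3 : π.bracket (fun z => e z i) (E.app fun z => e z j) x = P y := by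
    refine Eq.trans ?_ (bracket_coord hr0 he π hy i j)
    rw [BivField.bracket, dfAt_congr (happ j)]
    rfl
  rw [h1, h2, h3] at hlie
  linarith

end Charts

/-! ### Local expressions of maps and Jacobi morphisms. -/

section Maps

/-- The domain of the local expression of a map in two charts. -/
def locDomain {d : ℕ} {M S : Type*} [TopologicalSpace M] [TopologicalSpace S]
    (c : OpenPartialHomeomorph S (Model d)) (e : OpenPartialHomeomorph M (Model d))
    (φ : S → M) : Set (Model d) :=
  c.target ∩ c.symm ⁻¹' (φ ⁻¹' e.source)

/-- The local expression of a map in two charts. -/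
def locMap {d : ℕ} {M S : Type*} [TopologicalSpace M] [TopologicalSpace S]
    (c : OpenPartialHomeomorph S (Model d)) (e : OpenPartialHomeomorph M (Model d))
    (φ : S → M) (y : Model d) : Model d :=
  e (φ (c.symm y))

theorem isOpen_locDomain {d : ℕ} {M S : Type*} [TopologicalSpace M] [TopologicalSpace S]
    {e : OpenPartialHomeomorph M (Model d)} {c : OpenPartialHomeomorph S (Model d)} {φ : S → M}
    (hφ : Continuous φ) : IsOpen (locDomain c e φ) :=
  c.isOpen_inter_preimage_symm (e.open_source.preimage hφ)

theorem locMap_mem_target {d : ℕ} {M S : Type*} [TopologicalSpace M] [TopologicalSpace S]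
    {e : OpenPartialHomeomorph M (Model d)} {c : OpenPartialHomeomorph S (Model d)} {φ : S → M}
    {y : Model d} (hy : y ∈ locDomain c e φ) :
    locMap c e φ y ∈ e.target :=
  e.map_source hy.2

open IsManifold

variable {d : ℕ} {M S : Type*} [TopologicalSpace M] [ChartedSpace (Model d) M]
  [TopologicalSpace S] [ChartedSpace (Model d) S] {r : WithTop ℕ∞}
  {e : OpenPartialHomeomorph M (Model d)} {c : OpenPartialHomeomorph S (Model d)} {φ : S → M}

theorem contDiffOn_locMap (hc : c ∈ maximalAtlas (𝓡 d) r S) (he : e ∈ maximalAtlas (𝓡 d) r M)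
    (hφ : ContMDiff (𝓡 d) (𝓡 d) r φ) : ContDiffOn ℝ r (locMap c e φ) (locDomain c e φ) := by
  refine contMDiffOn_iff_contDiffOn.1 ?_
  exact (contMDiffOn_of_mem_maximalAtlas he).comp
    (hφ.comp_contMDiffOn ((contMDiffOn_symm_of_mem_maximalAtlas hc).mono Set.inter_subset_left))
    fun y hy => hy.2

theorem fderiv_locMap_chartDeriv (hr : r ≠ 0) (hc : c ∈ maximalAtlas (𝓡 d) r S)
    (he : e ∈ maximalAtlas (𝓡 d) r M) (hφ : ContMDiff (𝓡 d) (𝓡 d) r φ) {y : Model d}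
    (hy : y ∈ locDomain c e φ) :
    (fderiv ℝ (locMap c e φ) y).toLinearMap ∘ₗ chartDeriv c (c.symm y) =
      chartDeriv e (φ (c.symm y)) ∘ₗ (mfderiv (𝓡 d) (𝓡 d) φ (c.symm y)).toLinearMap := by
  set x := c.symm y
  have hx : x ∈ c.source := c.map_target hy.1
  have hxy : c x = y := c.right_inv hy.1
  have hopen := isOpen_locDomain (c := c) (e := e) hφ.continuous
  have hF : DifferentiableAt ℝ (locMap c e φ) (c x) := by
    rw [hxy]
    exact ((contDiffOn_locMap hc he hφ).contDiffAt (hopen.mem_nhds hy)).differentiableAt hr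
  have hcd := (mdifferentiable_of_mem_maximalAtlas hr hc).mdifferentiableAt hx
  have hed := (mdifferentiable_of_mem_maximalAtlas hr he).mdifferentiableAt hy.2
  have hφd : MDifferentiableAt (𝓡 d) (𝓡 d) φ x := hφ.mdifferentiable hr x
  have h1 : mfderiv (𝓡 d) 𝓘(ℝ, Model d) (locMap c e φ ∘ c) x =
      (mfderiv 𝓘(ℝ, Model d) 𝓘(ℝ, Model d) (locMap c e φ) (c x)).comp
        (mfderiv (𝓡 d) 𝓘(ℝ, Model d) c x) :=
    mfderiv_comp x hF.mdifferentiableAt hcd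
  have h2 : mfderiv (𝓡 d) 𝓘(ℝ, Model d) (e ∘ φ) x =
      (mfderiv (𝓡 d) 𝓘(ℝ, Model d) e (φ x)).comp (mfderiv (𝓡 d) (𝓡 d) φ x) :=
    mfderiv_comp x hed hφd
  have h3 : locMap c e φ ∘ c =ᶠ[𝓝 x] e ∘ φ := by
    refine Filter.eventuallyEq_of_mem (c.open_source.mem_nhds hx) fun z hz => ?_
    simp [locMap, c.left_inv hz]
  rw [mfderiv_eq_fderiv, hxy] at h1
  have h4 := h3.mfderiv_eq (I := 𝓡 d) (I' := 𝓘(ℝ, Model d))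
  rw [h1, h2] at h4
  refine LinearMap.ext fun v => ?_
  exact congrArg (fun T : TangentSpace (𝓡 d) x →L[ℝ] Model d => T v) h4

variable {πS : BivField d S} {ES : VField d S} {π : BivField d M} {E : VField d M}

theorem map_locBiv (hr : r ≠ 0) (hc : c ∈ maximalAtlas (𝓡 d) r S)
    (he : e ∈ maximalAtlas (𝓡 d) r M) (hφ : IsJacobiMorphism r πS ES π E φ) {y : Model d}
    (hy : y ∈ locDomain c e φ) :
    exteriorPower.map 2 (fderiv ℝ (locMap c e φ) y).toLinearMap (locBiv c πS y) =
      locBiv e π (locMap c e φ y) := by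
  rw [locMap, locBiv_apply π hy.2, ← hφ.map_biv, locBiv, ← LinearMap.comp_apply,
    ← LinearMap.comp_apply, ← exteriorPower.map_comp, ← exteriorPower.map_comp,
    fderiv_locMap_chartDeriv hr hc he hφ.smooth hy]

theorem map_locVec (hr : r ≠ 0) (hc : c ∈ maximalAtlas (𝓡 d) r S)
    (he : e ∈ maximalAtlas (𝓡 d) r M) (hφ : IsJacobiMorphism r πS ES π E φ) {y : Model d}
    (hy : y ∈ locDomain c e φ) :
    fderiv ℝ (locMap c e φ) y (locVec c ES y) = locVec e E (locMap c e φ y) := by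
  rw [locMap, locVec_apply E hy.2, ← hφ.map_vec, locVec]
  exact LinearMap.congr_fun (fderiv_locMap_chartDeriv hr hc he hφ.smooth hy) _

end Maps

/-! ### Regular points and the Jacobian. -/

section Regular

open IsManifold

variable {n : ℕ} {M : Type*} [TopologicalSpace M] [ChartedSpace (Model (2 * n + 1)) M]
  {r : WithTop ℕ∞}
  {e : OpenPartialHomeomorph M (Model (2 * n + 1))}

/-- The differential of a chart is injective, hence so is the map it induces on exterior algebras.
-/
theorem isRegularPt_iff (hr : r ≠ 0) (he : e ∈ maximalAtlas (𝓡 (2 * n + 1)) r M)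
    {π : BivField (2 * n + 1) M} {E : VField (2 * n + 1) M} {y : Model (2 * n + 1)}
    (hy : y ∈ e.target) :
    IsRegularPt π E (e.symm y) ↔ topCoord (locBiv e π y) (locVec e E y) ≠ 0 := by
  rw [Ne, topCoord_eq_zero_iff, locBiv, locVec, ← map_topForm]
  have hinj := ExteriorAlgebra.map_injective_field (chartDeriv_ker hr he (e.map_target hy))
  rw [map_eq_zero_iff _ hinj]
  rfl

variable {S : Type*} [TopologicalSpace S] [ChartedSpace (Model (2 * n + 1)) S]
  {c : OpenPartialHomeomorph S (Model (2 * n + 1))} {φ : S → M}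
  {πS : BivField (2 * n + 1) S} {ES : VField (2 * n + 1) S}
  {π : BivField (2 * n + 1) M} {E : VField (2 * n + 1) M}

theorem topCoord_locMap (hr : r ≠ 0) (hc : c ∈ maximalAtlas (𝓡 (2 * n + 1)) r S)
    (he : e ∈ maximalAtlas (𝓡 (2 * n + 1)) r M) (hφ : IsJacobiMorphism r πS ES π E φ)
    {y : Model (2 * n + 1)} (hy : y ∈ locDomain c e φ) :
    topCoord (locBiv e π (locMap c e φ y)) (locVec e E (locMap c e φ y)) =
      (fderiv ℝ (locMap c e φ) y).det * topCoord (locBiv c πS y) (locVec c ES y) := by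
  rw [← map_locBiv hr hc he hφ hy, ← map_locVec hr hc he hφ hy]
  exact topCoord_map _ _ _

theorem topCoord_ne_zero_of_regular (hr : r ≠ 0) (hc : c ∈ maximalAtlas (𝓡 (2 * n + 1)) r S)
    (hS : ∀ x, IsRegularPt πS ES x) {y : Model (2 * n + 1)} (hy : y ∈ c.target) :
    topCoord (locBiv c πS y) (locVec c ES y) ≠ 0 :=
  (isRegularPt_iff hr hc hy).1 (hS _)

/-- In `topCoord_locMap` the factor upstairs never vanishes, so the Jacobian carries all the zeros.
-/
theorem jacobian_eq_zero_iff (hr : r ≠ 0) (hc : c ∈ maximalAtlas (𝓡 (2 * n + 1)) r S)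
    (he : e ∈ maximalAtlas (𝓡 (2 * n + 1)) r M) (hφ : IsJacobiMorphism r πS ES π E φ)
    (hS : ∀ x, IsRegularPt πS ES x) {y : Model (2 * n + 1)} (hy : y ∈ locDomain c e φ) :
    (fderiv ℝ (locMap c e φ) y).det = 0 ↔ φ (c.symm y) ∈ singularLocus π E := by
  have h1 := topCoord_locMap hr hc he hφ hy
  have h2 := topCoord_ne_zero_of_regular hr hc hS hy.1
  have h3 := isRegularPt_iff hr he (π := π) (E := E) (locMap_mem_target hy)
  have h4 : e.symm (locMap c e φ y) = φ (c.symm y) := e.left_inv hy.2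
  rw [h4, h1] at h3
  simp only [singularLocus, Set.mem_ofPred_eq, h3, not_not, mul_eq_zero, h2, or_false]

end Regular

section

open IsManifold

/-! ### Homogeneity of the bivector in Euler coordinates. -/

section Euler

variable {d : ℕ} {M : Type*} [TopologicalSpace M] [ChartedSpace (Model d) M]
  {r : WithTop ℕ∞} {e : OpenPartialHomeomorph M (Model d)}

theorem locBiv_coeff_smul [IsManifold (𝓡 d) 1 M] (hr : ∞ ≤ r) (he : e ∈ maximalAtlas (𝓡 d) r M)
    {π : BivField d M} {E : VField d M} (hJ : IsJacobi r π E)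
    (hE : ∀ x ∈ e.source, ∀ i : Fin d, E.app (fun y => e y i) x = e x i) {ρ : ℝ}
    (hρ : Metric.ball 0 ρ ⊆ e.target) (i j : Fin d) :
    ∀ x ∈ Metric.ball (0 : Model d) ρ, ∀ t : ℝ, 0 < t → t • x ∈ Metric.ball (0 : Model d) ρ →
      bivectorEval (locBiv e π (t • x)) ((stdBasis d).coord i) ((stdBasis d).coord j) =
        t ^ 2 * bivectorEval (locBiv e π x) ((stdBasis d).coord i) ((stdBasis d).coord j) := by
  have hr0 : r ≠ 0 := (lt_of_lt_of_le (by simp) hr).ne'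
  intro x hx t ht htx
  refine homogeneous_of_euler (f := fun y =>
    bivectorEval (locBiv e π y) ((stdBasis d).coord i) ((stdBasis d).coord j)) (r := ρ) (k := 2)
    ?_ ?_ hx ht htx
  · exact ((contDiffOn_locBiv hr0 he hJ.smooth_biv i j).mono hρ).differentiableOn hr0
  · intro y hy
    exact_mod_cast fderiv_locBiv_euler hr he hJ hE i j (hρ hy)

theorem bivectorEval_smul {V : Type*} [AddCommGroup V] [Module ℝ V] (c : ℝ) (w : ⋀[ℝ]^2 V)
    (α β : Module.Dual ℝ V) : bivectorEval (c • w) α β = c * bivectorEval w α β := by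
  simp [bivectorEval]

end Euler

/-! ### The two obstructions to contact resolutions. -/

section Main

variable {n : ℕ} {M : Type*} [TopologicalSpace M] [ChartedSpace (Model (2 * n + 1)) M]
  {r : WithTop ℕ∞} {e : OpenPartialHomeomorph M (Model (2 * n + 1))}
  {π : BivField (2 * n + 1) M} {E : VField (2 * n + 1) M}

/-- Each of the `n` factors `π` contributes degree 2 and `E` contributes 1. That the total equals
the dimension is what makes the volume estimate critical. -/
theorem topCoord_euler_smul [IsManifold (𝓡 (2 * n + 1)) 1 M] (hr : ∞ ≤ r)
    (he : e ∈ maximalAtlas (𝓡 (2 * n + 1)) r M) (hJ : IsJacobi r π E)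
    (hE : ∀ x ∈ e.source, ∀ i, E.app (fun y => e y i) x = e x i) {ρ : ℝ}
    (hρ : Metric.ball 0 ρ ⊆ e.target) :
    ∀ x ∈ Metric.ball (0 : Model (2 * n + 1)) ρ, ∀ t : ℝ, 0 < t →
      t • x ∈ Metric.ball (0 : Model (2 * n + 1)) ρ →
      topCoord (locBiv e π (t • x)) (t • x) = t ^ (2 * n + 1) * topCoord (locBiv e π x) x := by
  intro x hx t ht htx
  have h : locBiv e π (t • x) = t ^ 2 • locBiv e π x := by
    refine bivector_ext (stdBasis _) fun i j => ?_
    rw [bivectorEval_smul]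
    exact locBiv_coeff_smul hr he hJ hE hρ i j x hx t ht htx
  rw [h, topCoord_smul]
  ring

theorem topCoord_euler_neg [IsManifold (𝓡 (2 * n + 1)) 1 M]
    (he : e ∈ maximalAtlas (𝓡 (2 * n + 1)) ω M) (hJ : IsJacobi ω π E)
    (hE : ∀ x ∈ e.source, ∀ i, E.app (fun y => e y i) x = e x i) {ρ : ℝ}
    (hρ : Metric.ball 0 ρ ⊆ e.target) :
    ∀ x ∈ Metric.ball (0 : Model (2 * n + 1)) ρ,
      topCoord (locBiv e π (-x)) (-x) = - topCoord (locBiv e π x) x := by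
  intro x hx
  have h : locBiv e π (-x) = locBiv e π x := by
    refine bivector_ext (stdBasis _) fun i j => ?_
    refine even_of_homogeneous (f := fun y =>
      bivectorEval (locBiv e π y) ((stdBasis _).coord i) ((stdBasis _).coord j)) (r := ρ) ?_
      (locBiv_coeff_smul le_top he hJ hE hρ i j) hx
    have h1 := (contDiffOn_locBiv (by simp) he hJ.smooth_biv i j).mono hρ
    exact (Metric.isOpen_ball.analyticOn_iff_analyticOnNhd).1 h1.analyticOn
  have h2 := topCoord_smul (locBiv e π x) x 1 (-1)
  simp only [one_smul, neg_smul, one_pow, one_mul, neg_mul] at h2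
  rw [h, h2]

theorem continuousOn_topCoord_euler [IsManifold (𝓡 (2 * n + 1)) 1 M] (hr : r ≠ 0)
    (he : e ∈ maximalAtlas (𝓡 (2 * n + 1)) r M) (hJ : IsJacobi r π E) :
    ContinuousOn (fun x => topCoord (locBiv e π x) x) e.target := fun _ hx =>
  continuousWithinAt_topCoord
    (fun i j => (contDiffOn_locBiv hr he hJ.smooth_biv i j).continuousOn _ hx)
    continuousWithinAt_id

variable {S : Type*} [TopologicalSpace S] [ChartedSpace (Model (2 * n + 1)) S]
  {φ : S → M} {πS : BivField (2 * n + 1) S} {ES : VField (2 * n + 1) S}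

/-- Near a point of the fibre over the centre of Euler coordinates, the Jacobian determinant of a
resolution is bounded by the power `dim M` of the distance to the centre. -/
theorem exists_jacobian_bound [IsManifold (𝓡 (2 * n + 1)) 1 M] [IsManifold (𝓡 (2 * n + 1)) ∞ S]
    (he : e ∈ maximalAtlas (𝓡 (2 * n + 1)) ∞ M) (hJ : IsJacobi ∞ π E)
    (hE : ∀ x ∈ e.source, ∀ i, E.app (fun y => e y i) x = e x i)
    (h : IsContactResolution ∞ πS ES π E φ) {s : S} (hs : φ s ∈ e.source) (hs0 : e (φ s) = 0) :
    ∃ U : Set (Model (2 * n + 1)), IsOpen U ∧ chartAt (Model (2 * n + 1)) s s ∈ U ∧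
      Bornology.IsBounded U ∧ U ⊆ locDomain (chartAt _ s) e φ ∧
      ∃ C : ℝ, 0 ≤ C ∧ ∀ y ∈ U, |(fderiv ℝ (locMap (chartAt _ s) e φ) y).det| ≤
        C * ‖locMap (chartAt _ s) e φ y‖ ^ (2 * n + 1) := by
  have hr : (∞ : WithTop ℕ∞) ≠ 0 := by simp
  set c := chartAt (Model (2 * n + 1)) s
  have hc : c ∈ maximalAtlas (𝓡 (2 * n + 1)) ∞ S := chart_mem_maximalAtlas s
  have hsc : s ∈ c.source := mem_chart_source _ s
  have hφ := h.morphism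
  have hΩ : IsOpen (locDomain c e φ) := isOpen_locDomain hφ.smooth.continuous
  have hy₀ : c s ∈ locDomain c e φ := ⟨c.map_source hsc, by
    rw [Set.mem_preimage, Set.mem_preimage, c.left_inv hsc]; exact hs⟩
  have hF0 : locMap c e φ (c s) = 0 := by rw [locMap, c.left_inv hsc, hs0]
  obtain ⟨ρ, hρ0, hρ⟩ : ∃ ρ > 0, Metric.ball (0 : Model (2 * n + 1)) ρ ⊆ e.target := by
    refine Metric.isOpen_iff.1 e.open_target 0 ?_
    rw [← hs0]
    exact e.map_source hs
  obtain ⟨C, hC, hbound⟩ := exists_bound_of_homogeneous (k := 2 * n + 1) hρ0 (by simp)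
    ((continuousOn_topCoord_euler hr he hJ).mono hρ) (topCoord_euler_smul le_rfl he hJ hE hρ)
  have hFc : ContinuousAt (locMap c e φ) (c s) :=
    ((contDiffOn_locMap hc he hφ.smooth).contDiffAt (hΩ.mem_nhds hy₀)).continuousAt
  set q : Model (2 * n + 1) → ℝ := fun y => topCoord (locBiv c πS y) (locVec c ES y)
  have hqc : ContinuousAt q (c s) := by
    have h1 : ContinuousOn q c.target := fun y hy => continuousWithinAt_topCoord
      (fun i j => (contDiffOn_locBiv hr hc h.contact.jacobi.smooth_biv i j).continuousOn _ hy)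
      ((contDiffOn_locVec_chartAt h.contact.jacobi.smooth_vec s).continuousOn _ hy)
    exact h1.continuousAt (c.open_target.mem_nhds hy₀.1)
  have hq0 : 0 < |q (c s)| :=
    abs_pos.2 (topCoord_ne_zero_of_regular hr hc h.contact.regular hy₀.1)
  -- Near `c s`, `|q|` exceeds half its value there, so dividing `f ∘ F = det DF · q` by `q` costs
  -- only a constant.
  set m := |q (c s)| / 2
  have hm : 0 < m := half_pos hq0
  have hev : ∀ᶠ y in 𝓝 (c s), m < |q y| ∧ locMap c e φ y ∈ Metric.ball 0 ρ ∧
      y ∈ locDomain c e φ ∧ y ∈ Metric.ball (c s) 1 := by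
    refine (hqc.abs.eventually (lt_mem_nhds (half_lt_self hq0))).and
      ((hFc.eventually (Metric.isOpen_ball.mem_nhds ?_)).and
      ((hΩ.eventually_mem hy₀).and (Metric.ball_mem_nhds _ one_pos)))
    rw [hF0]
    exact Metric.mem_ball_self hρ0
  obtain ⟨U, hU, hUo, hyU⟩ := eventually_nhds_iff.1 hev
  refine ⟨U, hUo, hyU, Metric.isBounded_ball.subset fun y hy => (hU y hy).2.2.2,
    fun y hy => (hU y hy).2.2.1, C / m, by positivity, fun y hy => ?_⟩
  obtain ⟨h1, h2, h3, -⟩ := hU y hy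
  have h4 := topCoord_locMap hr hc he hφ h3
  rw [locVec_euler hr he hE (hρ h2)] at h4
  have h5 := hbound _ h2
  rw [h4, abs_mul] at h5
  rw [div_mul_eq_mul_div, le_div_iff₀ hm]
  exact (mul_le_mul_of_nonneg_left h1.le (abs_nonneg _)).trans h5

theorem not_isProperMap_of_eulerType [IsManifold (𝓡 (2 * n + 1)) ∞ M] [T2Space M]
    [IsManifold (𝓡 (2 * n + 1)) ∞ S] {p : M}
    (hJ : IsJacobi ∞ π E) (hp : IsEulerTypeAt ∞ E p) (h : IsContactResolution ∞ πS ES π E φ) :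
    ¬ IsProperMap φ := by
  intro hprop
  obtain ⟨e, he, hpe, hp0, hE⟩ := hp
  have hφ := h.morphism
  have hloc : ∀ s : S, φ s = p → ∃ U : Set (Model (2 * n + 1)), IsOpen U ∧
      chartAt (Model (2 * n + 1)) s s ∈ U ∧ Bornology.IsBounded U ∧
      U ⊆ locDomain (chartAt _ s) e φ ∧
      ∃ C : ℝ, 0 ≤ C ∧ ∀ y ∈ U, |(fderiv ℝ (locMap (chartAt _ s) e φ) y).det| ≤
        C * ‖locMap (chartAt _ s) e φ y‖ ^ (2 * n + 1) := fun s hs =>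
    exists_jacobian_bound he hJ hE h (hs ▸ hpe) (by rw [hs, hp0])
  choose! U hUo hsU hUb hUΩ C hC hCJ using hloc
  have hcompact : IsCompact (φ ⁻¹' {p}) := hprop.isCompact_preimage isCompact_singleton
  set V : S → Set S := fun s =>
    (chartAt (Model (2 * n + 1)) s).source ∩ (chartAt (Model (2 * n + 1)) s) ⁻¹' U s
  obtain ⟨t, htp, ht⟩ := hcompact.elim_nhds_subcover V fun s hs =>
    ((chartAt (Model (2 * n + 1)) s).isOpen_inter_preimage (hUo s hs)).mem_nhds
      ⟨mem_chart_source _ s, hsU s hs⟩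
  have hVo : IsOpen (⋃ s ∈ t, V s) := isOpen_biUnion fun s hs =>
    (chartAt (Model (2 * n + 1)) s).isOpen_inter_preimage (hUo s (htp s hs))
  -- A proper map is closed, so the finite cover of the fibre over `p` also covers the fibres over
  -- all nearby points.
  have hclosed : IsClosed (φ '' (⋃ s ∈ t, V s)ᶜ) := hprop.isClosedMap _ hVo.isClosed_compl
  have hpn : p ∈ (φ '' (⋃ s ∈ t, V s)ᶜ)ᶜ := by
    rintro ⟨s, hs, hsp⟩
    exact hs (ht hsp)
  have h0t : (0 : Model (2 * n + 1)) ∈ e.target := hp0 ▸ e.map_source hpe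
  have hsymm0 : e.symm 0 = p := by rw [← hp0, e.left_inv hpe]
  have hev : ∀ᶠ x in 𝓝 (0 : Model (2 * n + 1)),
      x ∈ e.target ∧ e.symm x ∈ (φ '' (⋃ s ∈ t, V s)ᶜ)ᶜ := by
    refine (e.open_target.eventually_mem h0t).and ?_
    refine (e.continuousAt_symm h0t).eventually ?_
    rw [hsymm0]
    exact hclosed.isOpen_compl.mem_nhds hpn
  obtain ⟨ρ, hρ, hball⟩ := Metric.eventually_nhds_iff_ball.1 hev
  refine not_punctured_ball_subset_iUnion_image MeasureTheory.volume t
    (fun s => locMap (chartAt _ s) e φ) U (fun s hs => hUo s (htp s hs))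
    (fun s hs => (hUb s (htp s hs)).measure_lt_top.ne)
    (fun s hs => ?_) (fun s hs => ⟨C s, hC s (htp s hs), fun y hy => ?_⟩) hρ ?_
  · exact ((contDiffOn_locMap (chart_mem_maximalAtlas s) he hφ.smooth).mono
      (hUΩ s (htp s hs))).differentiableOn (by simp)
  · simpa using hCJ s (htp s hs) y hy
  · intro x _ hx
    obtain ⟨hxt, hxV⟩ := hball x (by simpa using hx)
    obtain ⟨s', hs'⟩ := h.surjective (e.symm x)
    have hmem : s' ∈ ⋃ s ∈ t, V s := by
      by_contra hcon
      exact hxV ⟨s', hcon, hs'⟩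
    obtain ⟨s, hst, hsV⟩ := Set.mem_iUnion₂.1 hmem
    refine ⟨s, hst, chartAt _ s s', hsV.2, ?_⟩
    rw [locMap, (chartAt (Model (2 * n + 1)) s).left_inv hsV.1, hs', e.right_inv hxt]

/-- For a semi-connected analytic resolution, no open set is mapped into the singular locus. -/
theorem not_eventually_singular [IsManifold (𝓡 (2 * n + 1)) ω M] [IsManifold (𝓡 (2 * n + 1)) ω S]
    (h : IsContactResolution ω πS ES π E φ) (hsc : IsSemiConnected π E φ) (s : S) :
    ¬ ∀ᶠ s' in 𝓝 s, φ s' ∈ singularLocus π E := by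
  set A : Set S := {s | ∀ᶠ s' in 𝓝 s, φ s' ∈ singularLocus π E}
  have hr : (ω : WithTop ℕ∞) ≠ 0 := by simp
  have hφ := h.morphism
  have hopen : IsOpen A := isOpen_iff_eventually.2 fun s hs => eventually_eventually_nhds.2 hs
  -- By the identity theorem on a ball in a chart, a Jacobian vanishing on an open piece of the ball
  -- vanishes on all of it. Thus `A` is clopen and contains the component of each of its points.
  have hclosed : IsClosed A := by
    refine isClosed_of_closure_subset fun s hs => ?_
    set c := chartAt (Model (2 * n + 1)) s
    set e := chartAt (Model (2 * n + 1)) (φ s)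
    have hc : c ∈ maximalAtlas (𝓡 (2 * n + 1)) ω S := chart_mem_maximalAtlas s
    have he : e ∈ maximalAtlas (𝓡 (2 * n + 1)) ω M := chart_mem_maximalAtlas (φ s)
    have hsc : s ∈ c.source := mem_chart_source _ s
    have hΩ : IsOpen (locDomain c e φ) := isOpen_locDomain hφ.smooth.continuous
    have hy₀ : c s ∈ locDomain c e φ := ⟨c.map_source hsc, by
      rw [Set.mem_preimage, Set.mem_preimage, c.left_inv hsc]; exact mem_chart_source _ (φ s)⟩
    obtain ⟨δ, hδ, hball⟩ := Metric.isOpen_iff.1 hΩ _ hy₀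
    have hN : c.source ∩ c ⁻¹' Metric.ball (c s) δ ∈ 𝓝 s :=
      (c.isOpen_inter_preimage Metric.isOpen_ball).mem_nhds ⟨hsc, Metric.mem_ball_self hδ⟩
    obtain ⟨s₁, ⟨hs₁c, hs₁b⟩, hs₁A⟩ := mem_closure_iff_nhds.1 hs _ hN
    have hJa := (analyticOnNhd_jacobian hΩ (contDiffOn_locMap hc he hφ.smooth)).mono hball
    have hev : (fun y => (fderiv ℝ (locMap c e φ) y).det) =ᶠ[𝓝 (c s₁)] 0 := by
      have h1 : ∀ᶠ y in 𝓝 (c s₁), φ (c.symm y) ∈ singularLocus π E :=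
        (c.continuousAt_symm (c.map_source hs₁c)).eventually (by rw [c.left_inv hs₁c]; exact hs₁A)
      filter_upwards [h1, Metric.isOpen_ball.mem_nhds hs₁b] with y hy hyb
      exact (jacobian_eq_zero_iff hr hc he hφ h.contact.regular (hball hyb)).2 hy
    have hzero := hJa.eqOn_zero_of_preconnected_of_eventuallyEq_zero
      (convex_ball _ _).isPreconnected hs₁b hev
    filter_upwards [hN] with s' hs'
    have h2 := (jacobian_eq_zero_iff hr hc he hφ h.contact.regular (hball hs'.2)).1 (hzero hs'.2)
    rwa [c.left_inv hs'.1] at h2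
  intro hs
  refine hsc s ?_
  rintro _ ⟨s', hs', rfl⟩
  have h1 : ∀ᶠ z in 𝓝 s', φ z ∈ singularLocus π E :=
    (IsClopen.connectedComponent_subset ⟨hclosed, hopen⟩ hs) hs'
  exact h1.self_of_nhds

theorem not_isSemiConnected_of_eulerType [IsManifold (𝓡 (2 * n + 1)) ω M]
    [SecondCountableTopology S] [IsManifold (𝓡 (2 * n + 1)) ω S] {p : M}
    (hJ : IsJacobi ω π E) (hd : IsContactOnDenseOpen π E) (hp : IsEulerTypeAt ω E p)
    (h : IsContactResolution ω πS ES π E φ) : ¬ IsSemiConnected π E φ := by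
  intro hsc
  have hr : (ω : WithTop ℕ∞) ≠ 0 := by simp
  obtain ⟨e, he, hpe, hp0, hE⟩ := hp
  have hφ := h.morphism
  obtain ⟨ρ, hρ0, hρ⟩ : ∃ ρ > 0, Metric.ball (0 : Model (2 * n + 1)) ρ ⊆ e.target := by
    refine Metric.isOpen_iff.1 e.open_target 0 ?_
    rw [← hp0]
    exact e.map_source hpe
  have hreg : ∀ x ∈ e.target, topCoord (locBiv e π x) x = 0 ↔ e.symm x ∈ singularLocus π E := by
    intro x hx
    have h1 := isRegularPt_iff hr he (π := π) (E := E) hx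
    rw [locVec_euler hr he hE hx] at h1
    simp only [singularLocus, Set.mem_ofPred_eq, h1, not_not]
  have hne : ∃ x ∈ Metric.ball (0 : Model (2 * n + 1)) ρ, topCoord (locBiv e π x) x ≠ 0 := by
    obtain ⟨U, hUo, hUd, hU⟩ := hd
    obtain ⟨z, ⟨hze, hzb⟩, hzU⟩ := hUd.inter_open_nonempty
      (e.source ∩ e ⁻¹' Metric.ball 0 ρ) (e.isOpen_inter_preimage Metric.isOpen_ball)
      ⟨p, hpe, by rw [Set.mem_preimage, hp0]; exact Metric.mem_ball_self hρ0⟩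
    refine ⟨e z, hzb, fun h0 => ?_⟩
    have := (hreg _ (hρ hzb)).1 h0
    rw [e.left_inv hze] at this
    exact this (hU z hzU)
  obtain ⟨pr, δ, hδ, hpr⟩ := exists_projection_zeros (G := Model (2 * n)) (by simp)
    ((continuousOn_topCoord_euler hr he hJ).mono hρ) (topCoord_euler_neg he hJ hE hρ) hne
  -- The projected critical values seen in one chart; each such set is null.
  set Z : S → Set (Model (2 * n)) := fun s =>
    (fun y => pr (locMap (chartAt _ s) e φ y)) ''
      {y ∈ locDomain (chartAt _ s) e φ | (fderiv ℝ (locMap (chartAt _ s) e φ) y).det = 0}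
  have hZ : ∀ s, MeasureTheory.volume (Z s) = 0 := by
    intro s
    have hc : chartAt (Model (2 * n + 1)) s ∈ maximalAtlas (𝓡 (2 * n + 1)) ω S :=
      chart_mem_maximalAtlas s
    have hsub : locDomain (chartAt (Model (2 * n + 1)) s) e φ ⊆
      (chartAt (Model (2 * n + 1)) s).target := Set.inter_subset_left
    refine measure_image_critical_eq_zero MeasureTheory.volume (by simp) pr
      (isOpen_locDomain hφ.smooth.continuous) e.open_target
      (contDiffOn_locMap hc he hφ.smooth) (fun y hy => locMap_mem_target hy)
      (w := locBiv (chartAt _ s) πS) (W := locBiv e π) (ε := locVec (chartAt _ s) ES) (Y := id)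
      (fun i j => ((contDiffOn_locBiv hr hc h.contact.jacobi.smooth_biv i j).mono hsub).of_le
        le_top)
      (((contDiffOn_locVec_chartAt h.contact.jacobi.smooth_vec s).mono hsub).of_le le_top)
      (fun i j => (contDiffOn_locBiv hr he hJ.smooth_biv i j).of_le le_top) contDiffOn_id
      (fun y hy => topCoord_ne_zero_of_regular hr hc h.contact.regular hy.1)
      (fun y hy => map_locBiv hr hc he hφ hy) (fun y hy => ?_) (fun y hy hev => ?_)
    · rw [map_locVec hr hc he hφ hy, locVec_euler hr he hE (locMap_mem_target hy), id]
    · refine not_eventually_singular h hsc ((chartAt (Model (2 * n + 1)) s).symm y) ?_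
      have hcont := (chartAt (Model (2 * n + 1)) s).continuousAt
        ((chartAt (Model (2 * n + 1)) s).map_target hy.1)
      have hΩ : IsOpen (locDomain (chartAt (Model (2 * n + 1)) s) e φ) :=
        isOpen_locDomain hφ.smooth.continuous
      have hev2 : ∀ᶠ y' in 𝓝 y, φ ((chartAt (Model (2 * n + 1)) s).symm y') ∈
          singularLocus π E := by
        filter_upwards [hev, hΩ.mem_nhds hy] with y' h1 h2
        exact (jacobian_eq_zero_iff hr hc he hφ h.contact.regular h2).1 h1
      have hy2 := (chartAt (Model (2 * n + 1)) s).right_inv hy.1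
      filter_upwards [hcont.eventually (by rw [hy2]; exact hev2),
        (chartAt (Model (2 * n + 1)) s).open_source.mem_nhds
          ((chartAt (Model (2 * n + 1)) s).map_target hy.1)] with s' h1 h2
      rwa [(chartAt (Model (2 * n + 1)) s).left_inv h2] at h1
  obtain ⟨t, htc, ht⟩ := TopologicalSpace.countable_cover_nhds
    (fun s : S => (chartAt (Model (2 * n + 1)) s).open_source.mem_nhds (mem_chart_source _ s))
  -- Each point of the ball is the projection of a zero of `f`, which by surjectivity has a
  -- preimage, necessarily critical. Countably many null sets would thus cover a ball.
  have hcov : Metric.ball (0 : Model (2 * n)) δ ⊆ ⋃ s ∈ t, Z s := by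
    intro q hq
    obtain ⟨x, hx, hfx, rfl⟩ := hpr q hq
    obtain ⟨s', hs'⟩ := h.surjective (e.symm x)
    have hmem : s' ∈ ⋃ s ∈ t, (chartAt (Model (2 * n + 1)) s).source := ht ▸ Set.mem_univ s'
    obtain ⟨s, hst, hss⟩ := Set.mem_iUnion₂.1 hmem
    have hleft := (chartAt (Model (2 * n + 1)) s).left_inv hss
    have hdom : chartAt (Model (2 * n + 1)) s s' ∈ locDomain (chartAt _ s) e φ := by
      refine ⟨(chartAt (Model (2 * n + 1)) s).map_source hss, ?_⟩
      rw [Set.mem_preimage, Set.mem_preimage, hleft, hs']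
      exact e.map_target (hρ hx)
    refine Set.mem_iUnion₂.2 ⟨s, hst, chartAt _ s s', ⟨hdom, ?_⟩, ?_⟩
    · refine (jacobian_eq_zero_iff hr (chart_mem_maximalAtlas s) he hφ h.contact.regular hdom).2 ?_
      rw [hleft, hs']
      exact (hreg x (hρ hx)).1 hfx
    · simp only [locMap]
      rw [hleft, hs', e.right_inv (hρ hx)]
  have hpos := Metric.measure_ball_pos MeasureTheory.volume (0 : Model (2 * n)) hδ
  exact hpos.ne' (MeasureTheory.measure_mono_null hcov
    ((MeasureTheory.measure_biUnion_null_iff htc).2 fun s _ => hZ s))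

end Main

end

end

end JacobiGeom

theorem mainTheorem8 (n : ℕ) :
    (∀ (M : Type u) [TopologicalSpace M] [T2Space M] [SecondCountableTopology M]
        [ChartedSpace (JacobiGeom.Model (2 * n + 1)) M] [IsManifold (𝓡 (2 * n + 1)) ∞ M]
        (π : JacobiGeom.BivField (2 * n + 1) M) (E : JacobiGeom.VField (2 * n + 1) M) (p : M),
      JacobiGeom.IsJacobi ∞ π E → JacobiGeom.IsContactOnDenseOpen π E →
      JacobiGeom.IsEulerTypeAt ∞ E p →
      ∀ (S : Type v) [TopologicalSpace S] [T2Space S] [SecondCountableTopology S]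
        [ChartedSpace (JacobiGeom.Model (2 * n + 1)) S] [IsManifold (𝓡 (2 * n + 1)) ∞ S]
        (πS : JacobiGeom.BivField (2 * n + 1) S) (ES : JacobiGeom.VField (2 * n + 1) S)
        (φ : S → M),
      JacobiGeom.IsContactResolution ∞ πS ES π E φ → ¬ IsProperMap φ) ∧
    (∀ (M : Type u) [TopologicalSpace M] [T2Space M] [SecondCountableTopology M]
        [ChartedSpace (JacobiGeom.Model (2 * n + 1)) M] [IsManifold (𝓡 (2 * n + 1)) ω M]
        (π : JacobiGeom.BivField (2 * n + 1) M) (E : JacobiGeom.VField (2 * n + 1) M) (p : M),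
      JacobiGeom.IsJacobi ω π E → JacobiGeom.IsContactOnDenseOpen π E →
      JacobiGeom.IsEulerTypeAt ω E p →
      ∀ (S : Type v) [TopologicalSpace S] [T2Space S] [SecondCountableTopology S]
        [ChartedSpace (JacobiGeom.Model (2 * n + 1)) S] [IsManifold (𝓡 (2 * n + 1)) ω S]
        (πS : JacobiGeom.BivField (2 * n + 1) S) (ES : JacobiGeom.VField (2 * n + 1) S)
        (φ : S → M),
      JacobiGeom.IsContactResolution ω πS ES π E φ → ¬ JacobiGeom.IsSemiConnected π E φ) := by
  refine ⟨?_, ?_⟩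
  · intro M _ _ _ _ _ π E p hJ _ hp S _ _ _ _ _ πS ES φ h
    exact JacobiGeom.not_isProperMap_of_eulerType hJ hp h
  · intro M _ _ _ _ _ π E p hJ hd hp S _ _ _ _ _ πS ES φ h
    exact JacobiGeom.not_isSemiConnected_of_eulerType hJ hd hp h
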